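/- Let $X=((X_t)_{t\ge 0},(\mathbb P_i)_{i\in S})$ be an irreducible, non-explosive continuous time Markov chain on a countable state space $S$, with finite and conservative $q$-matrix $Q=(q_{ij})$, i.e. $q_{ij}=p_{ij}'(0)$ where $p_{ij}(t)=\mathbb P_i(X_t=j)$, and $\sum_{j}q_{ij}=0$ for all $i$. Let $D\subseteq S$, $E=S\setminus D$, $T=\inf\{t\ge 0: X_t\in D\}$, $E_\Delta=E\cup\{\Delta\}$ with a cemetery point $\Delta$, and let $X^T_t=X_t$ if $t<T$, $X^T_t=\Delta$ if $t\ge T$, be the killed chain. Let $P^T(t)=(p^T_{ij}(t))_{i,j\in E_\Delta}$ be its transition probability ($p^T_{ij}(t)=\mathbb P_i(X^T_t=j)$ for $i\in E$, $p^T_{\Delta j}(t)=1_{j=\Delta}$), let $\eta_i=\sum_{j\in D}q_{ij}$ for $i\in E$, and let $Q^T=(q^T_{ij})_{i,j\in E_\Delta}$ be its $q$-matrix: $q^T_{ij}=q_{ij}$ for $i,j\in E$, $q^T_{i\Delta}=\eta_i$, $q^T_{\Delta j}=0$. Let $\mu$ be a probability distribution on $E_\Delta$ with $\mu_\Delta=0$,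 let $\mathbb P_\mu=\sum_{i\in E}\mu_i\mathbb P_i$, let $\mu_i(t)=\mathbb P_\mu(X^T_t=i\mid T>t)$ for $i\in E_\Delta$, and let $\delta$ be the row vector with $\delta_\Delta=1$ and $\delta_i=0$ for $i\in E$. For $J=(0,\infty)$ or $J=[0,\infty)$ and $\alpha>0$ consider the following conditions, in which vectors are differentiated coordinate by coordinate (with the right derivative at $t=0$), the series on the right-hand sides are required to converge absolutely, and $\mu Q^TP^T(t)$ is the vector with entries $\sum_{i}\mu_i\sum_k q^T_{ik}p^T_{kj}(t)$: * $(\mathrm D_J)$: $\mu P^T(t)$ is differentiable and $\frac{d}{dt}\,\mu P^T(t)=\mu\,\frac{d}{dt}P^T(t)$ for all $t\in J$; * $(\mathrm O_J^\alpha)$: $\mu(t)$ is differentiable and $\mu'(t)=e^{\alpha t}\,(\mu Q^T+\alpha(\mu-\delta))P^T(t)=e^{\alpha t}\bigl(\mu Q^TP^T(t)+\alpha(\mu-\delta)P^T(t)\bigr)$ for all $t\in J$. Then for every $\alpha>0$: (i) for each of the two choices of $J$, if $(\mathrm D_J)$ holds, then $\mathbb P_\mu(T>t)=e^{-\alpha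 t}$ for all $t\ge 0$ if and only if $(\mathrm O_J^\alpha)$ holds; (ii) for each of the two choices of $J$, if $\mathbb P_\mu(T>t)=e^{-\alpha t}$ for all $t\ge 0$, then $(\mathrm D_J)$ and $(\mathrm O_J^\alpha)$ are equivalent; (iii) if $(\mathrm O_{[0,\infty)}^\alpha)$ holds, then $\alpha=\sum_{i\in E}\eta_i\mu_i$. -/

import Mathlib

open Set MeasureTheory ProbabilityTheory Filter Topology

noncomputable section

namespace KilledChain

/-- `X = (X_t)_{t ≥ 0}`, under the laws `(P i)_{i ∈ S}`, is a time homogeneous, non-explosive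
continuous time Markov chain on the (discrete, countable) state space `S`. Time is `[0, ∞)`:
only the values `X t` with `0 ≤ t` matter.

The Markov property is stated with respect to the past `σ(X_u, 0 ≤ u ≤ s)`. Non-explosion is part of
the path regularity: every path is right continuous with left limits in the discrete space `S`,
that is, it is a step function with finitely many jumps on each bounded time interval. -/
structure IsMarkovChain {S Ω : Type*} [MeasurableSpace S] [MeasurableSpace Ω]
    (P : S → Measure Ω) (X : ℝ → Ω → S) : Prop where
  isProbabilityMeasure : ∀ i, IsProbabilityMeasure (P i)
  measurable : ∀ t, 0 ≤ t → Measurable (X t)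
  start : ∀ i, ∀ᵐ ω ∂(P i), X 0 ω = i
  markov : ∀ (i : S) (s t : ℝ), 0 ≤ s → 0 ≤ t → ∀ A : Set Ω,
    MeasurableSet[⨆ u ∈ Icc 0 s, MeasurableSpace.comap (X u) inferInstance] A →
    ∀ j k : S, P i (A ∩ {ω | X s ω = j} ∩ {ω | X (s + t) ω = k})
      = P i (A ∩ {ω | X s ω = j}) * P j {ω | X t ω = k}
  right_continuous : ∀ ω t, 0 ≤ t → ∀ᶠ s in 𝓝[>] t, X s ω = X t ω
  left_limit : ∀ ω t, 0 < t → ∃ j, ∀ᶠ s in 𝓝[<] t, X s ω = j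

/-- The transition probability `p_{ij}(t) = P_i(X_t = j)`. -/
def transition {S Ω : Type*} [MeasurableSpace Ω] (P : S → Measure Ω) (X : ℝ → Ω → S)
    (i j : S) (t : ℝ) : ℝ :=
  (P i).real {ω | X t ω = j}

/-- Irreducibility: every state can be reached from every state. -/
def IsIrreducible {S Ω : Type*} [MeasurableSpace Ω] (P : S → Measure Ω) (X : ℝ → Ω → S) : Prop :=
  ∀ i j : S, ∃ t, 0 ≤ t ∧ 0 < transition P X i j t

/-- `Q` is the (finite) `q`-matrix of the chain: `q_{ij} = p'_{ij}(0)` (right derivative). -/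
def IsQMatrix {S Ω : Type*} [MeasurableSpace Ω] (P : S → Measure Ω) (X : ℝ → Ω → S)
    (Q : S → S → ℝ) : Prop :=
  ∀ i j : S, HasDerivWithinAt (transition P X i j) (Q i j) (Ici 0) 0

/-- `Q` is conservative: all its row sums vanish. -/
def IsConservative {S : Type*} (Q : S → S → ℝ) : Prop :=
  ∀ i : S, HasSum (fun j => Q i j) 0

/-- `E = S \ D`. -/
abbrev Alive {S : Type*} (D : Set S) : Type _ := {i : S // i ∉ D}

/-- `E_Δ = E ∪ {Δ}`; the cemetery point `Δ` is `none`. -/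
abbrev AliveΔ {S : Type*} (D : Set S) : Type _ := Option (Alive D)

/-- The first passage time `T = inf {t ≥ 0 : X_t ∈ D}`, with `inf ∅ = ∞`. -/
def passageTime {S Ω : Type*} (X : ℝ → Ω → S) (D : Set S) : Ω → WithTop ℝ :=
  hittingAfter X D 0

/-- The event `{T > t}`. -/
def survival {S Ω : Type*} (X : ℝ → Ω → S) (D : Set S) (t : ℝ) : Set Ω :=
  {ω | (t : WithTop ℝ) < passageTime X D ω}

open scoped Classical in
/-- The killed process: `X^T_t = X_t` if `t < T` and `X^T_t = Δ` if `t ≥ T`. -/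
def killed {S Ω : Type*} (X : ℝ → Ω → S) (D : Set S) (t : ℝ) (ω : Ω) : AliveΔ D :=
  if h : 0 ≤ t ∧ ω ∈ survival X D t then
    some ⟨X t ω, notMem_of_lt_hittingAfter h.2 h.1⟩
  else none

/-- The killing rates `η_i = ∑_{j ∈ D} q_{ij}`, `i ∈ E`. -/
def killingRate {S : Type*} (Q : S → S → ℝ) (D : Set S) (i : Alive D) : ℝ :=
  ∑' j : D, Q i j

/-- The `q`-matrix `Q^T` of the killed process. -/
def killedQ {S : Type*} (Q : S → S → ℝ) (D : Set S) : AliveΔ D → AliveΔ D → ℝ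
  | some i, some j => Q i j
  | some i, none => killingRate Q D i
  | none, _ => 0

open scoped Classical in
/-- The transition probability `P^T(t)` of the killed process:
`p^T_{ij}(t) = P_i(X^T_t = j)` for `i ∈ E`, and `Δ` is absorbing. -/
def killedTransition {S Ω : Type*} [MeasurableSpace Ω] (P : S → Measure Ω) (X : ℝ → Ω → S)
    (D : Set S) : AliveΔ D → AliveΔ D → ℝ → ℝ
  | some i, j, t => (P i).real {ω | killed X D t ω = j}
  | none, j, _ => if j = none then 1 else 0

/-- `μ` is a probability distribution on `E_Δ` that does not charge `Δ`. -/
structure IsDistribution {S : Type*} {D : Set S} (μ : AliveΔ D → ℝ) : Prop where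
  nonneg : ∀ i, 0 ≤ μ i
  hasSum : HasSum μ 1
  cemetery : μ none = 0

/-- `P_μ = ∑_{i ∈ E} μ_i P_i`. -/
def initialLaw {S Ω : Type*} [MeasurableSpace Ω] (P : S → Measure Ω) {D : Set S}
    (μ : AliveΔ D → ℝ) : Measure Ω :=
  Measure.sum fun i : Alive D => ENNReal.ofReal (μ (some i)) • P i

/-- `T` is exponentially distributed with parameter `α` under `P_μ`. -/
def IsExponential {S Ω : Type*} [MeasurableSpace Ω] (P : S → Measure Ω) (X : ℝ → Ω → S)
    (D : Set S) (μ : AliveΔ D → ℝ) (α : ℝ) : Prop :=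
  ∀ t, 0 ≤ t → (initialLaw P μ).real (survival X D t) = Real.exp (-α * t)

/-- The conditional law `μ_i(t) = P_μ(X^T_t = i | T > t)`, `i ∈ E_Δ`. -/
def conditionalLaw {S Ω : Type*} [MeasurableSpace Ω] (P : S → Measure Ω) (X : ℝ → Ω → S)
    (D : Set S) (μ : AliveΔ D → ℝ) (i : AliveΔ D) (t : ℝ) : ℝ :=
  (cond (initialLaw P μ) (survival X D t)).real {ω | killed X D t ω = i}

/-- The vector `δ`: `δ_Δ = 1` and `δ_i = 0` for `i ∈ E`. -/
def cemeteryDelta {S : Type*} (D : Set S) : AliveΔ D → ℝ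
  | none => 1
  | some _ => 0

/-- The row vector `ν P^T(t)`. -/
def mulTransition {S Ω : Type*} [MeasurableSpace Ω] (P : S → Measure Ω) (X : ℝ → Ω → S)
    (D : Set S) (ν : AliveΔ D → ℝ) (j : AliveΔ D) (t : ℝ) : ℝ :=
  ∑' i, ν i * killedTransition P X D i j t

/-- The differentiability condition at the times `t ∈ J`, for `J ⊆ [0, ∞)`: `μ P^T(t)` is
differentiable and may be differentiated term by term, `d/dt μ P^T(t) = μ (d/dt P^T(t))`,
the series on the right being convergent. Derivatives are taken in `[0, ∞)`: they are ordinary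
derivatives at `t > 0` and right derivatives at `0`. -/
def DifferentiabilityCondition {S Ω : Type*} [MeasurableSpace Ω] (P : S → Measure Ω)
    (X : ℝ → Ω → S) (D : Set S) (μ : AliveΔ D → ℝ) (J : Set ℝ) : Prop :=
  ∀ j : AliveΔ D, ∀ t ∈ J,
    (∀ i, DifferentiableWithinAt ℝ (killedTransition P X D i j) (Ici 0) t) ∧
    ∃ d : ℝ, HasSum (fun i => μ i * derivWithin (killedTransition P X D i j) (Ici 0) t) d ∧
      HasDerivWithinAt (mulTransition P X D μ j) d (Ici 0) t

/-- The equation `μ'(t) = e^{α t} (μ Q^T + α (μ - δ)) P^T(t)` at the times `t ∈ J`, for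
`J ⊆ [0, ∞)`, coordinate by coordinate. Here `μ Q^T P^T(t)` is the product of `μ` with the matrix
`Q^T P^T(t)` (the right side of the backward equation), the series involved being convergent. -/
def ConditionalLawEquation {S Ω : Type*} [MeasurableSpace Ω] (P : S → Measure Ω)
    (X : ℝ → Ω → S) (Q : S → S → ℝ) (D : Set S) (μ : AliveΔ D → ℝ) (α : ℝ) (J : Set ℝ) : Prop :=
  ∀ j : AliveΔ D, ∀ t ∈ J,
    ∃ d : ℝ, HasSum (fun i => μ i * ∑' k, killedQ Q D i k * killedTransition P X D k j t) d ∧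
      HasDerivWithinAt (conditionalLaw P X D μ j)
        (Real.exp (α * t) *
          (d + α * mulTransition P X D (fun i => μ i - cemeteryDelta D i) j t)) (Ici 0) t

end KilledChain

end

/-!
Write `E = S \ D`. Everything rests on the backward equation `d/dt P^T(t) = Q^T P^T(t)` on
`[0, ∞)` for the killed chain (`IsMarkovChain.hasDerivWithinAt_killedTransition`). By it, the
termwise derivative of `μ P^T(t)` is `μ Q^T P^T(t)`, and the theorem becomes calculus:

* If `P_μ(T > t) = e^{-αt}`, then `μ_j(t) = e^{αt} (μ P^T(t))_j` for `j ∈ E`, and the product rule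
  turns the derivative of one side into that of the other
  (`IsExponential.hasDerivWithinAt_iff`).
* Conversely, `μ_Δ(t) = 0` for all `t`, so the coordinate `Δ` of the equation for `μ'(t)` says that
  `(μ Q^T P^T(t))_Δ = α P_μ(T > t)` (`ConditionalLawEquation.hasSum_none`). At `t = 0` this is
  `∑ η_i μ_i = α`; if `μ P^T(t)` may be differentiated term by term, it says that
  `t ↦ P_μ(T > t)` solves `f' = -α f`, which with continuity at `0` and `f 0 = 1` gives
  `f t = e^{-αt}`.

The backward equation follows from the Chapman-Kolmogorov equation and from `P^T'(0) = Q^T`: as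
`Q^T` is conservative, the difference quotients of each row of `P^T` at `0` converge to that of
`Q^T` in `ℓ¹` (`tendsto_tsum_abs_slope_sub`), and then `h⁻¹ (P^T(h) - 1) P^T(t) → Q^T P^T(t)`
uniformly in `t` (`hasDerivWithinAt_backward`).

Both facts about `P^T` come from observing the path on dyadic grids. By right continuity, `T > t`
means that the path avoids `D` on all dyadic grids of `[0, t]` (`iInter_gridAvoids`). On a grid the
killed chain is a product of matrices (`IsMarkovChain.measure_gridAvoids`), and a limit gives its
Markov property (`IsMarkovChain.measure_avoids`). For the derivative at `0`, counting the grid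
paths with at most one jump gives `p^T_{ii}(t) ≥ e^{q_{ii} t}` and
`p^T_{ij}(t) ≥ t q_{ij} e^{(q_{ii} + q_{jj}) t}` for `i ≠ j` in `E`; since `p^T_{ij} ≤ p_{ij}`, the
slope at `0` is squeezed to `q_{ij}`. The killing rates `q^T_{iΔ} = η_i` are obtained from these by
conservativity.
-/

noncomputable section

namespace KilledChain

open scoped ENNReal

/-! ### Survival and time grids -/

section Paths

variable {S Ω : Type*}

/-- The event that the path avoids `D` throughout the time interval `[s, s + t]`. -/
def avoids (X : ℝ → Ω → S) (D : Set S) (s t : ℝ) : Set Ω :=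
  {ω | ∀ u ∈ Icc s (s + t), X u ω ∉ D}

/-- The event that the path avoids `D` at the grid times `s, s + h, …, s + n h`. -/
def gridAvoids (X : ℝ → Ω → S) (D : Set S) (s h : ℝ) (n : ℕ) : Set Ω :=
  {ω | ∀ m : ℕ, m ≤ n → X (s + m * h) ω ∉ D}

/-- By right continuity a path which is outside `D` at time `t` stays there for a while, so that
`T > t` as soon as `D` is avoided on the closed interval `[0, t]`. -/
lemma mem_survival_iff {X : ℝ → Ω → S} (D : Set S)
    (hr : ∀ ω t, 0 ≤ t → ∀ᶠ s in 𝓝[>] t, X s ω = X t ω) {t : ℝ} (ht : 0 ≤ t) (ω : Ω) :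
    ω ∈ survival X D t ↔ ω ∈ avoids X D 0 t := by
  simp only [survival, passageTime, avoids, mem_ofPred_eq, zero_add]
  constructor
  · intro h u hu
    exact notMem_of_lt_hittingAfter (lt_of_le_of_lt (WithTop.coe_le_coe.2 hu.2) h) hu.1
  · intro h
    rw [hittingAfter]
    split_ifs with hex
    · rw [WithTop.coe_lt_coe]
      obtain ⟨ε, hε, hεs⟩ := mem_nhdsGT_iff_exists_Ioo_subset.1 (hr ω t ht)
      refine lt_of_lt_of_le (show t < ε from hε) (le_csInf hex ?_)
      rintro u ⟨hu0, huD⟩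
      by_contra! hlt
      rcases le_or_gt u t with hut | hut
      · exact h u ⟨hu0, hut⟩ huD
      · have : X u ω = X t ω := hεs ⟨hut, hlt⟩
        exact h t ⟨ht, le_rfl⟩ (this ▸ huD)
    · exact WithTop.coe_lt_top _

/-- By right continuity, avoiding `D` on an interval is the same as avoiding it on all dyadic grids
of that interval. -/
lemma iInter_gridAvoids {X : ℝ → Ω → S} (D : Set S)
    (hr : ∀ ω t, 0 ≤ t → ∀ᶠ s in 𝓝[>] t, X s ω = X t ω) {s t : ℝ} (hs : 0 ≤ s) (ht : 0 ≤ t) :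
    ⋂ n : ℕ, gridAvoids X D s (t / 2 ^ n) (2 ^ n) = avoids X D s t := by
  ext ω
  simp only [mem_iInter, gridAvoids, avoids, mem_ofPred_eq]
  constructor
  · intro h u hu
    rcases eq_or_lt_of_le hu.2 with rfl | hlt
    · simpa using h 0 1 (by simp)
    · have ht' : 0 < t := by linarith [hu.1]
      obtain ⟨ε, hε, hεs⟩ := mem_nhdsGT_iff_exists_Ioo_subset.1 (hr ω u (hs.trans hu.1))
      have hε : u < ε := hε
      obtain ⟨n, hn⟩ := exists_pow_lt_of_lt_one (div_pos (sub_pos.2 hε) ht')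
        (by norm_num : (1 / 2 : ℝ) < 1)
      rw [lt_div_iff₀ ht', one_div, inv_pow, inv_mul_eq_div] at hn
      -- the first point of a sufficiently fine grid after `u` lies where the path is still at `X_u`
      set d := t / 2 ^ n with hd
      have hd0 : 0 < d := by positivity
      have hus : 0 ≤ (u - s) / d := div_nonneg (sub_nonneg.2 hu.1) hd0.le
      have h1 := Nat.lt_floor_add_one ((u - s) / d)
      have h2 := Nat.floor_le hus
      rw [div_lt_iff₀ hd0] at h1
      rw [le_div_iff₀ hd0] at h2
      have h3 : ⌊(u - s) / d⌋₊ + 1 ≤ 2 ^ n := by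
        rw [Nat.succ_le_iff, Nat.floor_lt hus, div_lt_iff₀ hd0, hd]
        push_cast
        rw [mul_div_cancel₀ _ (by positivity)]
        linarith
      have h4 : X (s + ((⌊(u - s) / d⌋₊ + 1 : ℕ) : ℝ) * d) ω = X u ω := by
        refine hεs ⟨?_, ?_⟩
        · push_cast; linarith
        · push_cast; linarith
      exact h4 ▸ h n _ h3
  · intro h n m hm
    have hm' : (m : ℝ) ≤ 2 ^ n := by exact_mod_cast hm
    refine h _ ⟨?_, ?_⟩
    · have : 0 ≤ (m : ℝ) * (t / 2 ^ n) := by positivity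
      linarith
    · have : (m : ℝ) * (t / 2 ^ n) ≤ 2 ^ n * (t / 2 ^ n) := by gcongr
      rw [mul_div_cancel₀ _ (by positivity)] at this
      linarith

lemma antitone_gridAvoids (X : ℝ → Ω → S) (D : Set S) (s t : ℝ) :
    Antitone fun n : ℕ => gridAvoids X D s (t / 2 ^ n) (2 ^ n) := by
  refine antitone_nat_of_succ_le fun n ω h m hm => ?_
  have := h (2 * m) (by rw [pow_succ]; omega)
  have e : s + ((2 * m : ℕ) : ℝ) * (t / 2 ^ (n + 1)) = s + m * (t / 2 ^ n) := by
    push_cast; field_simp; ring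
  rwa [e] at this

lemma gridAvoids_succ (X : ℝ → Ω → S) (D : Set S) (s h : ℝ) (n : ℕ) :
    gridAvoids X D s h (n + 1) = {ω | X s ω ∉ D} ∩ gridAvoids X D (s + h) h n := by
  ext ω
  simp only [gridAvoids, mem_inter_iff, mem_ofPred_eq]
  constructor
  · intro H
    refine ⟨by simpa using H 0 (by omega), fun m hm => ?_⟩
    have := H (m + 1) (by omega)
    rwa [show s + ((m + 1 : ℕ) : ℝ) * h = s + h + m * h by push_cast; ring] at this
  · rintro ⟨h0, H⟩ m hm
    cases m with
    | zero => simpa using h0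
    | succ m =>
      rw [show s + ((m + 1 : ℕ) : ℝ) * h = s + h + m * h by push_cast; ring]
      exact H m (by omega)

lemma avoids_add (X : ℝ → Ω → S) (D : Set S) {s t : ℝ} (hs : 0 ≤ s) (ht : 0 ≤ t) :
    avoids X D 0 (s + t) = avoids X D 0 s ∩ avoids X D s t := by
  ext ω
  simp only [avoids, mem_inter_iff, mem_ofPred_eq, zero_add]
  constructor
  · exact fun h => ⟨fun u hu => h u ⟨hu.1, by linarith [hu.2]⟩,
      fun u hu => h u ⟨hs.trans hu.1, hu.2⟩⟩
  · rintro ⟨h1, h2⟩ u hu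
    rcases le_total u s with h | h
    · exact h1 u ⟨hu.1, h⟩
    · exact h2 u ⟨h, hu.2⟩

end Paths

section Grid

variable {S Ω : Type*} [MeasurableSpace S]

/-- The `σ`-algebra `σ(X_u, 0 ≤ u ≤ s)`, which appears in the Markov property. -/
abbrev past (X : ℝ → Ω → S) (s : ℝ) : MeasurableSpace Ω :=
  ⨆ u ∈ Icc 0 s, MeasurableSpace.comap (X u) inferInstance

lemma past_mono (X : ℝ → Ω → S) {s t : ℝ} (h : s ≤ t) : past X s ≤ past X t :=
  iSup₂_le fun u hu => le_iSup₂_of_le u ⟨hu.1, hu.2.trans h⟩ le_rfl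

lemma measurableSet_past (X : ℝ → Ω → S) {s u : ℝ} (hu : u ∈ Icc 0 s) {B : Set S}
    (hB : MeasurableSet B) : MeasurableSet[past X s] {ω | X u ω ∈ B} := by
  have h : MeasurableSpace.comap (X u) inferInstance ≤ past X s :=
    le_iSup₂_of_le (f := fun u (_ : u ∈ Icc 0 s) => MeasurableSpace.comap (X u) inferInstance)
      u hu le_rfl
  exact h _ ⟨B, hB, rfl⟩

lemma measurableSet_past_gridAvoids [DiscreteMeasurableSpace S] (X : ℝ → Ω → S) (D : Set S)
    {s h : ℝ} (hs : 0 ≤ s) (hh : 0 ≤ h) (n : ℕ) :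
    MeasurableSet[past X (s + n * h)] (gridAvoids X D s h n) := by
  have : gridAvoids X D s h n = ⋂ m ∈ Iic n, {ω | X (s + m * h) ω ∈ Dᶜ} := by
    ext; simp [gridAvoids]
  rw [this]
  refine MeasurableSet.biInter (to_countable _) fun m hm => ?_
  have hm : (m : ℝ) ≤ n := by exact_mod_cast hm
  exact measurableSet_past X ⟨by positivity, by gcongr⟩ (MeasurableSet.of_discrete)

lemma measurableSet_past_avoids [DiscreteMeasurableSpace S] {X : ℝ → Ω → S} (D : Set S)
    (hr : ∀ ω t, 0 ≤ t → ∀ᶠ s in 𝓝[>] t, X s ω = X t ω) {s t : ℝ} (hs : 0 ≤ s) (ht : 0 ≤ t) :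
    MeasurableSet[past X (s + t)] (avoids X D s t) := by
  rw [← iInter_gridAvoids D hr hs ht]
  refine MeasurableSet.iInter fun n => ?_
  have := measurableSet_past_gridAvoids X D hs (div_nonneg ht (by positivity : (0:ℝ) ≤ 2 ^ n))
    (2 ^ n)
  rwa [show s + ((2 ^ n : ℕ) : ℝ) * (t / 2 ^ n) = s + t by push_cast; field_simp] at this

variable [MeasurableSpace Ω]

lemma IsMarkovChain.past_le {P : S → Measure Ω} {X : ℝ → Ω → S} (hX : IsMarkovChain P X) (s : ℝ) :
    past X s ≤ (inferInstance : MeasurableSpace Ω) :=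
  iSup₂_le fun u hu => (hX.measurable u hu.1).comap_le

/-- The weight `∑ p(j, l₁) p(l₁, l₂) ⋯ p(lₙ₋₁, k)` of the paths `j, l₁, …, k` of length `n` of the
skeleton chain with step `h` all of whose states, end points included, lie outside `D`. -/
def gridKernel (P : S → Measure Ω) (X : ℝ → Ω → S) (D : Set S) (h : ℝ) : ℕ → S → S → ℝ≥0∞
  | 0, j, k => ({k} \ D : Set S).indicator 1 j
  | n + 1, j, k => Dᶜ.indicator (fun j => ∑' l, P j {ω | X h ω = l} * gridKernel P X D h n l k) j

lemma measure_eq_tsum_fiber {L Ω : Type*} [Countable L] [MeasurableSpace Ω] (ν : Measure Ω)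
    {Y : Ω → L} (hY : ∀ l, MeasurableSet {ω | Y ω = l}) {B : Set Ω} (hB : MeasurableSet B) :
    ν B = ∑' l, ν (B ∩ {ω | Y ω = l}) := by
  rw [← measure_iUnion]
  · congr 1; ext; simp
  · intro a b hab
    exact Set.disjoint_left.2 fun ω h1 h2 => hab (h1.2.symm.trans h2.2)
  · exact fun l => hB.inter (hY l)

lemma IsMarkovChain.measurableSet_eq [DiscreteMeasurableSpace S] {P : S → Measure Ω}
    {X : ℝ → Ω → S} (hX : IsMarkovChain P X) {t : ℝ} (ht : 0 ≤ t) (k : S) :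
    MeasurableSet {ω | X t ω = k} :=
  hX.measurable t ht (MeasurableSet.of_discrete (s := {k}))

variable [Countable S] [DiscreteMeasurableSpace S]

variable {P : S → Measure Ω} {X : ℝ → Ω → S}

/-- The Markov property at time `s` for the future observed on a grid, with killing in `D`. -/
lemma IsMarkovChain.measure_gridAvoids (hX : IsMarkovChain P X) (D : Set S) {h : ℝ} (hh : 0 ≤ h)
    (i k : S) (n : ℕ) (j : S) (s : ℝ) (hs : 0 ≤ s) (A : Set Ω) (hA : MeasurableSet[past X s] A) :
    P i (A ∩ {ω | X s ω = j} ∩ (gridAvoids X D s h n ∩ {ω | X (s + n * h) ω = k}))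
      = P i (A ∩ {ω | X s ω = j}) * gridKernel P X D h n j k := by
  induction n generalizing j s A with
  | zero =>
    by_cases hj : j = k ∧ j ∉ D
    · obtain ⟨rfl, hjD⟩ := hj
      have : A ∩ {ω | X s ω = j} ∩ (gridAvoids X D s h 0 ∩ {ω | X (s + (0 : ℕ) * h) ω = j})
          = A ∩ {ω | X s ω = j} := by
        ext ω
        simp only [gridAvoids, mem_inter_iff, mem_ofPred_eq]
        constructor
        · exact fun h => h.1
        · rintro ⟨h1, rfl⟩
          refine ⟨⟨h1, rfl⟩, fun m hm => ?_, by simp⟩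
          obtain rfl : m = 0 := by omega
          simpa using hjD
      rw [this]
      simp [gridKernel, hjD]
    · have : A ∩ {ω | X s ω = j} ∩ (gridAvoids X D s h 0 ∩ {ω | X (s + (0 : ℕ) * h) ω = k})
          = ∅ := by
        ext ω
        simp only [gridAvoids, mem_inter_iff, mem_ofPred_eq, mem_empty_iff_false, iff_false]
        rintro ⟨⟨_, rfl⟩, h2, rfl⟩
        exact hj ⟨by simp, by simpa using h2 0 le_rfl⟩
      rw [this]
      have h2 : j ∉ ({k} \ D : Set S) := fun h => hj ⟨h.1, h.2⟩
      simp [gridKernel, h2]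
  | succ n ih =>
    have hs' : 0 ≤ s + h := by positivity
    have hsets : A ∩ {ω | X s ω = j} ∩
          (gridAvoids X D s h (n + 1) ∩ {ω | X (s + (n + 1 : ℕ) * h) ω = k})
        = A ∩ {ω | X s ω = j} ∩ {ω | X s ω ∉ D} ∩
          (gridAvoids X D (s + h) h n ∩ {ω | X (s + h + n * h) ω = k}) := by
      rw [gridAvoids_succ, show s + ((n + 1 : ℕ) : ℝ) * h = s + h + n * h by push_cast; ring]
      ext; simp only [mem_inter_iff]; tauto
    rw [hsets]
    by_cases hj : j ∈ D
    · have : A ∩ {ω | X s ω = j} ∩ {ω | X s ω ∉ D} = ∅ := by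
        ext ω
        simp only [mem_inter_iff, mem_ofPred_eq, mem_empty_iff_false, iff_false]
        rintro ⟨⟨_, rfl⟩, h⟩
        exact h hj
      rw [this]
      simp [gridKernel, hj]
    · have : A ∩ {ω | X s ω = j} ∩ {ω | X s ω ∉ D} = A ∩ {ω | X s ω = j} := by
        ext ω
        simp only [mem_inter_iff, mem_ofPred_eq, and_iff_left_iff_imp]
        rintro ⟨_, rfl⟩
        exact hj
      rw [this]
      have hA' : MeasurableSet[past X (s + h)] (A ∩ {ω | X s ω = j}) :=
        (past_mono X (by linarith) _ hA).inter
          (measurableSet_past X (B := {j}) ⟨hs, by linarith⟩ MeasurableSet.of_discrete)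
      have hG : MeasurableSet (gridAvoids X D (s + h) h n ∩ {ω | X (s + h + n * h) ω = k}) :=
        (hX.past_le _ _ (measurableSet_past_gridAvoids X D hs' hh n)).inter
          (hX.measurableSet_eq (by positivity) k)
      rw [measure_eq_tsum_fiber (P i) (hX.measurableSet_eq hs') ((hX.past_le _ _ hA').inter hG)]
      simp only [gridKernel, indicator_of_mem (show j ∈ Dᶜ from hj)]
      rw [← ENNReal.tsum_mul_left]
      refine tsum_congr fun l => ?_
      rw [inter_right_comm, ih l (s + h) hs' _ hA', hX.markov i s h hs hh A hA j l, mul_assoc]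

end Grid

/-! ### The backward equation -/

section Backward

variable {K : Type*}

/-- If the rows `p h` are probability vectors with `p 0 = δ_i` and with coordinatewise right
derivative `q` at `0`, where `q` has total mass `0`, then the difference quotients converge to `q`
even in `ℓ¹`. This is Scheffé's argument: the difference has total mass `0`, so its `ℓ¹` norm is
twice the mass of a one-sided part, which is dominated since the difference quotients are
nonnegative off `i`. -/
lemma tendsto_tsum_abs_slope_sub {p : K → ℝ → ℝ} {q : K → ℝ} (i : K)
    (hp : ∀ k t, 0 ≤ t → 0 ≤ p k t) (hsum : ∀ t, 0 ≤ t → HasSum (fun k => p k t) 1)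
    (h0 : ∀ k, k ≠ i → p k 0 = 0)
    (hd : ∀ k, HasDerivWithinAt (p k) (q k) (Ici 0) 0) (hq : HasSum q 0) :
    Tendsto (fun h => ∑' k, |(p k h - p k 0) / h - q k|) (𝓝[>] 0) (𝓝 0) := by
  classical
  have hslope : ∀ k, Tendsto (fun h => (p k h - p k 0) / h) (𝓝[>] 0) (𝓝 (q k)) := fun k => by
    have := hasDerivWithinAt_iff_tendsto_slope.1 (hd k)
    rw [Ici_sdiff_left] at this
    refine this.congr fun h => ?_
    simp [slope_def_field]
  have hlim : Tendsto (fun h => ∑' k, 2 * max (q k - (p k h - p k 0) / h) 0) (𝓝[>] 0)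
      (𝓝 (∑' _ : K, (0 : ℝ))) := by
    refine tendsto_tsum_of_dominated_convergence
      (bound := fun k => 2 * |q k| + 2 * (if k = i then 1 else 0)) ?_ (fun k => ?_) ?_
    · exact (hq.summable.abs.mul_left 2).add
        ((hasSum_ite_eq i (1 : ℝ)).summable.mul_left 2)
    · have := (((tendsto_const_nhds (x := q k)).sub (hslope k)).max
        (tendsto_const_nhds (x := (0 : ℝ)))).const_mul 2
      simpa using this
    · have hi : ∀ᶠ h in 𝓝[>] (0 : ℝ), q i - 1 < (p i h - p i 0) / h :=
        (hslope i).eventually_const_lt (by linarith)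
      filter_upwards [hi, self_mem_nhdsWithin] with h hh hpos k
      have hpos : 0 < h := hpos
      rw [Real.norm_of_nonneg (by positivity), ← mul_add]
      gcongr
      by_cases hk : k = i
      · subst hk
        simp only [if_true]
        exact max_le (by linarith [abs_nonneg (q k)]) (by positivity)
      · have : 0 ≤ (p k h - p k 0) / h := by
          rw [h0 k hk, sub_zero]; exact div_nonneg (hp k h hpos.le) hpos.le
        simp only [hk, if_false, add_zero]
        exact max_le (by linarith [le_abs_self (q k)]) (by positivity)
  rw [tsum_zero] at hlim
  refine hlim.congr' ?_
  filter_upwards [self_mem_nhdsWithin] with h hpos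
  have hpos : 0 < h := hpos
  have hs : HasSum (fun k => (p k h - p k 0) / h - q k) 0 := by
    simpa using (((hsum h hpos.le).sub (hsum 0 le_rfl)).div_const h).sub hq
  have hmax : ∀ x : ℝ, |x| = x + 2 * max (-x) 0 := fun x => by
    rcases le_total 0 x with hx | hx
    · rw [abs_of_nonneg hx, max_eq_right (by linarith)]; ring
    · rw [abs_of_nonpos hx, max_eq_left (by linarith)]; ring
  have hs2 : Summable fun k => 2 * max (q k - (p k h - p k 0) / h) 0 := by
    refine (hs.summable.abs.sub hs.summable).congr fun k => ?_
    rw [hmax, neg_sub]; ring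
  have := hs.add hs2.hasSum
  rw [zero_add] at this
  rw [← this.tsum_eq]
  refine tsum_congr fun k => ?_
  rw [hmax, neg_sub]

/-- Kolmogorov's backward equation: if the bounded functions `u k` satisfy `u(h + s) = P(h) u(s)`
for a family `P(h)` of stochastic matrices with conservative derivative `q` at `0`, then
`u' = q u` on `[0, ∞)`. -/
theorem hasDerivWithinAt_backward {p : K → K → ℝ → ℝ} {q : K → K → ℝ} {u : K → ℝ → ℝ}
    (hp : ∀ i k t, 0 ≤ t → 0 ≤ p i k t) (hsum : ∀ i t, 0 ≤ t → HasSum (fun k => p i k t) 1)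
    (h0 : ∀ i k, k ≠ i → p i k 0 = 0)
    (hd : ∀ i k, HasDerivWithinAt (p i k) (q i k) (Ici 0) 0) (hq : ∀ i, HasSum (q i) 0)
    (hu : ∀ k s, 0 ≤ s → |u k s| ≤ 1)
    (hadd : ∀ i h s, 0 ≤ h → 0 ≤ s → u i (h + s) = ∑' k, p i k h * u k s)
    (i : K) {t : ℝ} (ht : 0 ≤ t) :
    HasDerivWithinAt (u i) (∑' k, q i k * u k t) (Ici 0) t := by
  -- multiplying a summable family by the bounded vector `u s`
  have hbdd : ∀ {f : K → ℝ}, Summable f → ∀ s, 0 ≤ s →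
      Summable (fun k => f k * u k s) ∧ |∑' k, f k * u k s| ≤ ∑' k, |f k| := fun {f} hf s hs => by
    have hle : ∀ k, ‖f k * u k s‖ ≤ |f k| := fun k => by
      rw [Real.norm_eq_abs, abs_mul]
      exact mul_le_of_le_one_right (abs_nonneg _) (hu k s hs)
    refine ⟨Summable.of_norm_bounded hf.abs hle, ?_⟩
    rw [← Real.norm_eq_abs]
    exact tsum_of_norm_bounded hf.abs.hasSum hle
  set e : K → ℝ → ℝ := fun i h => ∑' k, |(p i k h - p i k 0) / h - q i k| with he
  have he0 : ∀ i, Tendsto (e i) (𝓝[>] 0) (𝓝 0) := fun i =>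
    tendsto_tsum_abs_slope_sub i (hp i) (hsum i) (h0 i) (hd i) (hq i)
  -- the increment of `u` over `[s, s + h]`, with an error which is uniform in `s`
  have key : ∀ i s h, 0 ≤ s → 0 < h →
      |u i (h + s) - u i s - h * ∑' k, q i k * u k s| ≤ h * e i h := fun i s h hs hh => by
    have s1 := (hbdd (hsum i h hh.le).summable s hs).1
    have s0 := (hbdd (hsum i 0 le_rfl).summable s hs).1
    have s2 := (hbdd (hq i).summable s hs).1
    have e0 : u i s = ∑' k, p i k 0 * u k s := by simpa using hadd i 0 s le_rfl hs
    have hsm : Summable fun k => (p i k h - p i k 0) / h - q i k :=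
      ((((hsum i h hh.le).sub (hsum i 0 le_rfl)).div_const h).sub (hq i)).summable
    have heq : u i (h + s) - u i s - h * ∑' k, q i k * u k s
        = h * ∑' k, ((p i k h - p i k 0) / h - q i k) * u k s := by
      rw [hadd i h s hh.le hs]
      nth_rewrite 1 [e0]
      rw [← s1.tsum_sub s0, ← tsum_mul_left, ← (s1.sub s0).tsum_sub (s2.mul_left h),
        ← tsum_mul_left]
      refine tsum_congr fun k => ?_
      field_simp
    rw [heq, abs_mul, abs_of_pos hh]
    exact mul_le_mul_of_nonneg_left (hbdd hsm s hs).2 hh.le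
  have hcont : ∀ k, ContinuousWithinAt (u k) (Ici 0) t := by
    intro k
    set C := ∑' l, |q k l| with hC
    have hw : Tendsto (fun h => h * (C + e k h)) (𝓝[>] 0) (𝓝 0) := by
      have h1 : Tendsto (fun h : ℝ => h) (𝓝[>] 0) (𝓝 0) := tendsto_nhdsWithin_of_tendsto_nhds
        tendsto_id
      simpa using h1.mul ((he0 k).const_add C)
    have hinc : ∀ s h, 0 ≤ s → 0 < h → |u k (h + s) - u k s| ≤ h * (C + e k h) :=
      fun s h hs hh => by
        have h1 := key k s h hs hh
        have h2 := (hbdd (hq k).summable s hs).2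
        have h3 : |h * ∑' l, q k l * u l s| ≤ h * C := by
          rw [abs_mul, abs_of_pos hh]; exact mul_le_mul_of_nonneg_left h2 hh.le
        have h4 := abs_add_le (u k (h + s) - u k s - h * ∑' l, q k l * u l s)
          (h * ∑' l, q k l * u l s)
        rw [sub_add_cancel] at h4
        linarith
    rw [Metric.continuousWithinAt_iff]
    intro ε hε
    obtain ⟨δ, hδ, hδs⟩ := mem_nhdsGT_iff_exists_Ioo_subset.1 (hw.eventually_lt_const hε)
    refine ⟨δ, hδ, fun s hs hst => ?_⟩
    have hs : 0 ≤ s := hs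
    rw [Real.dist_eq] at hst ⊢
    rcases lt_trichotomy s t with hlt | rfl | hlt
    · have h1 := hinc s (t - s) hs (by linarith)
      have h2 : (t - s) * (C + e k (t - s)) < ε :=
        hδs ⟨by linarith, by rw [abs_of_neg (by linarith)] at hst; linarith⟩
      rw [sub_add_cancel, abs_sub_comm] at h1
      linarith
    · simpa using hε
    · have h1 := hinc t (s - t) ht (by linarith)
      have h2 : (s - t) * (C + e k (s - t)) < ε :=
        hδs ⟨by linarith, by rw [abs_of_pos (by linarith)] at hst; linarith⟩
      rw [sub_add_cancel] at h1
      linarith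
  have hg : ContinuousWithinAt (fun s => ∑' k, q i k * u k s) (Ici 0) t := by
    refine tendsto_tsum_of_dominated_convergence (hq i).summable.abs
      (fun k => ((hcont k).tendsto).const_mul _) ?_
    filter_upwards [self_mem_nhdsWithin] with s hs k
    rw [Real.norm_eq_abs, abs_mul]
    exact mul_le_of_le_one_right (abs_nonneg _) (hu k s hs)
  rw [hasDerivWithinAt_iff_isLittleO, Asymptotics.isLittleO_iff]
  intro ε hε
  have hε2 : 0 < ε / 2 := by positivity
  obtain ⟨δ, hδ, hδs⟩ := mem_nhdsGT_iff_exists_Ioo_subset.1 ((he0 i).eventually_lt_const hε2)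
  filter_upwards [Metric.tendsto_nhds.1 hg _ hε2, self_mem_nhdsWithin,
    mem_nhdsWithin_of_mem_nhds (Metric.ball_mem_nhds t hδ)] with s hgs hs hst
  have hs : 0 ≤ s := hs
  rw [Metric.mem_ball, Real.dist_eq] at hst
  rw [Real.dist_eq] at hgs
  simp only [Real.norm_eq_abs, smul_eq_mul]
  set g := fun s => ∑' k, q i k * u k s with hgdef
  change |g s - g t| < _ at hgs
  change |u i s - u i t - (s - t) * g t| ≤ _
  rcases lt_trichotomy s t with hlt | rfl | hlt
  -- to the left of `t` the increment starts at `s`, and `g s` is close to `g t` by continuity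
  · have h1 : |u i t - u i s - (t - s) * g s| ≤ (t - s) * e i (t - s) := by
      simpa using key i s (t - s) hs (by linarith)
    have h2 : e i (t - s) < ε / 2 :=
      hδs ⟨by linarith, by rw [abs_of_neg (by linarith)] at hst; linarith⟩
    have h3 : u i s - u i t - (s - t) * g t
        = -(u i t - u i s - (t - s) * g s) + (t - s) * -(g s - g t) := by ring
    rw [h3]
    refine (abs_add_le _ _).trans ?_
    rw [abs_neg, abs_mul, abs_neg, abs_sub_comm s t, abs_of_pos (sub_pos.2 hlt)]
    nlinarith
  · simp
  · have h1 : |u i s - u i t - (s - t) * g t| ≤ (s - t) * e i (s - t) := by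
      simpa using key i t (s - t) ht (by linarith)
    have h2 : e i (s - t) < ε / 2 :=
      hδs ⟨by linarith, by rw [abs_of_pos (by linarith)] at hst; linarith⟩
    rw [abs_of_pos (sub_pos.2 hlt)]
    nlinarith

end Backward

/-! ### The Markov property of the killed chain -/

section Kernel

variable {S Ω : Type*} [MeasurableSpace Ω]

/-- The sub-Markovian kernel `P_j(T > t, X_t = k)`, with values in `[0, ∞]` and indexed by all
states; it vanishes if `k ∈ D`. -/
def aliveKernel (P : S → Measure Ω) (X : ℝ → Ω → S) (D : Set S) (t : ℝ) (j k : S) : ℝ≥0∞ :=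
  P j (avoids X D 0 t ∩ {ω | X t ω = k})

lemma aliveKernel_of_mem (P : S → Measure Ω) (X : ℝ → Ω → S) {D : Set S} {t : ℝ} (ht : 0 ≤ t)
    (j : S) {k : S} (hk : k ∈ D) : aliveKernel P X D t j k = 0 := by
  have : avoids X D 0 t ∩ {ω | X t ω = k} = ∅ := by
    ext ω
    simp only [avoids, mem_inter_iff, mem_ofPred_eq, mem_empty_iff_false, iff_false]
    rintro ⟨h, rfl⟩
    exact h t ⟨ht, by simp⟩ hk
  rw [aliveKernel, this, measure_empty]

variable [MeasurableSpace S]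

variable {P : S → Measure Ω} {X : ℝ → Ω → S}

/-- Conditioning on `X_0 = j` is harmless under `P_j`; the event is in the form in which it appears
in the Markov property at time `0`. -/
lemma IsMarkovChain.measure_inter_start (hX : IsMarkovChain P X) (j : S) (B : Set Ω) :
    P j (univ ∩ {ω | X 0 ω = j} ∩ B) = P j B := by
  refine measure_congr ?_
  filter_upwards [hX.start j] with ω hω
  refine propext ⟨fun h => h.2, fun h => ⟨⟨mem_univ _, hω⟩, h⟩⟩

lemma IsMarkovChain.measure_start (hX : IsMarkovChain P X) (j : S) :
    P j (univ ∩ {ω | X 0 ω = j}) = 1 := by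
  have := hX.isProbabilityMeasure j
  have := hX.measure_inter_start j univ
  rwa [inter_univ, measure_univ] at this

variable [DiscreteMeasurableSpace S]

lemma IsMarkovChain.measurableSet_avoids (hX : IsMarkovChain P X) (D : Set S) {s t : ℝ}
    (hs : 0 ≤ s) (ht : 0 ≤ t) : MeasurableSet (avoids X D s t) :=
  hX.past_le _ _ (measurableSet_past_avoids D hX.right_continuous hs ht)

lemma IsMarkovChain.tendsto_measure_gridAvoids (hX : IsMarkovChain P X) (D : Set S) (i k : S)
    {s t : ℝ} (hs : 0 ≤ s) (ht : 0 ≤ t) {B : Set Ω} (hB : MeasurableSet B) :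
    Tendsto (fun n : ℕ => P i (B ∩ (gridAvoids X D s (t / 2 ^ n) (2 ^ n) ∩
        {ω | X (s + (2 ^ n : ℕ) * (t / 2 ^ n)) ω = k}))) atTop
      (𝓝 (P i (B ∩ (avoids X D s t ∩ {ω | X (s + t) ω = k})))) := by
  have := hX.isProbabilityMeasure i
  have e : ∀ n : ℕ, s + ((2 ^ n : ℕ) : ℝ) * (t / 2 ^ n) = s + t := fun n => by
    push_cast; field_simp
  simp only [e]
  have hset : B ∩ (avoids X D s t ∩ {ω | X (s + t) ω = k})
      = ⋂ n : ℕ, B ∩ (gridAvoids X D s (t / 2 ^ n) (2 ^ n) ∩ {ω | X (s + t) ω = k}) := by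
    rw [← inter_iInter, ← iInter_inter, iInter_gridAvoids D hX.right_continuous hs ht]
  rw [hset]
  refine tendsto_measure_iInter_atTop (fun n => ?_) ?_ ⟨0, measure_ne_top _ _⟩
  · refine (hB.inter (MeasurableSet.inter (hX.past_le _ _ (measurableSet_past_gridAvoids X D hs
      (by positivity) _)) (hX.measurableSet_eq (by positivity) k))).nullMeasurableSet
  · intro m n hmn
    exact inter_subset_inter_right _
      (inter_subset_inter_left _ (antitone_gridAvoids X D s t hmn))

variable [Countable S]

lemma IsMarkovChain.gridKernel_eq (hX : IsMarkovChain P X) (D : Set S) {h : ℝ} (hh : 0 ≤ h)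
    (n : ℕ) (j k : S) :
    gridKernel P X D h n j k = P j (gridAvoids X D 0 h n ∩ {ω | X (0 + n * h) ω = k}) := by
  have := hX.measure_gridAvoids D hh j k n j 0 le_rfl univ MeasurableSet.univ
  rw [hX.measure_inter_start, hX.measure_start, one_mul] at this
  exact this.symm

lemma IsMarkovChain.tendsto_gridKernel (hX : IsMarkovChain P X) (D : Set S) (j k : S) {t : ℝ}
    (ht : 0 ≤ t) :
    Tendsto (fun n : ℕ => gridKernel P X D (t / 2 ^ n) (2 ^ n) j k) atTop
      (𝓝 (aliveKernel P X D t j k)) := by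
  have := hX.tendsto_measure_gridAvoids D j k le_rfl ht MeasurableSet.univ
  simp only [univ_inter, zero_add (t : ℝ)] at this
  refine this.congr fun n => ?_
  rw [hX.gridKernel_eq D (by positivity)]

/-- The Markov property at time `s` for the chain killed in `D`, obtained from the one on grids by
refining the grid. -/
theorem IsMarkovChain.measure_avoids (hX : IsMarkovChain P X) (D : Set S) (i j k : S) {s t : ℝ}
    (hs : 0 ≤ s) (ht : 0 ≤ t) {A : Set Ω} (hA : MeasurableSet[past X s] A) :
    P i (A ∩ {ω | X s ω = j} ∩ (avoids X D s t ∩ {ω | X (s + t) ω = k}))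
      = P i (A ∩ {ω | X s ω = j}) * aliveKernel P X D t j k := by
  have := hX.isProbabilityMeasure i
  have h1 := hX.tendsto_measure_gridAvoids D i k hs ht
    ((hX.past_le _ _ hA).inter (hX.measurableSet_eq hs j))
  have h2 := ENNReal.Tendsto.const_mul (a := P i (A ∩ {ω | X s ω = j}))
    (hX.tendsto_gridKernel D j k ht) (Or.inr (measure_ne_top _ _))
  refine tendsto_nhds_unique h1 (h2.congr fun n => ?_)
  rw [hX.measure_gridAvoids D (by positivity) i k _ j s hs A hA]

/-- The Chapman-Kolmogorov equation for the killed chain. -/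
theorem IsMarkovChain.aliveKernel_add (hX : IsMarkovChain P X) (D : Set S) {s t : ℝ}
    (hs : 0 ≤ s) (ht : 0 ≤ t) (i k : S) :
    aliveKernel P X D (s + t) i k
      = ∑' j, aliveKernel P X D s i j * aliveKernel P X D t j k := by
  rw [aliveKernel, measure_eq_tsum_fiber (P i) (hX.measurableSet_eq hs)
    ((hX.measurableSet_avoids D le_rfl (add_nonneg hs ht)).inter
      (hX.measurableSet_eq (add_nonneg hs ht) k))]
  refine tsum_congr fun j => ?_
  have hA := measurableSet_past_avoids D hX.right_continuous le_rfl hs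
  rw [zero_add] at hA
  rw [aliveKernel, ← hX.measure_avoids D i j k hs ht hA, avoids_add X D hs ht]
  congr 1
  ext; simp only [mem_inter_iff]; tauto

lemma IsMarkovChain.tsum_aliveKernel (hX : IsMarkovChain P X) (D : Set S) {t : ℝ} (ht : 0 ≤ t)
    (i : S) : ∑' k, aliveKernel P X D t i k = P i (avoids X D 0 t) :=
  (measure_eq_tsum_fiber (P i) (hX.measurableSet_eq ht)
    (hX.measurableSet_avoids D le_rfl ht)).symm

lemma IsMarkovChain.measure_avoids_add (hX : IsMarkovChain P X) (D : Set S) {s t : ℝ}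
    (hs : 0 ≤ s) (ht : 0 ≤ t) (i : S) :
    P i (avoids X D 0 (s + t)) = ∑' j, aliveKernel P X D s i j * P j (avoids X D 0 t) := by
  simp only [← hX.tsum_aliveKernel D (add_nonneg hs ht), ← hX.tsum_aliveKernel D ht,
    hX.aliveKernel_add D hs ht, ← ENNReal.tsum_mul_left]
  exact ENNReal.tsum_comm

end Kernel

/-! ### Derivatives at time zero -/

section DerivativeAtZero

lemma tendsto_two_pow : Tendsto (fun n : ℕ => 2 ^ n) atTop (atTop : Filter ℕ) :=
  tendsto_pow_atTop_atTop_of_one_lt (by norm_num)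

lemma hasDerivWithinAt_zero_of_le_of_le {f g k : ℝ → ℝ} {q : ℝ}
    (hf : HasDerivWithinAt f q (Ici 0) 0) (hk : HasDerivWithinAt k q (Ici 0) 0)
    (hfg : ∀ t, 0 < t → f t ≤ g t) (hgk : ∀ t, 0 < t → g t ≤ k t) (hf0 : f 0 = g 0)
    (hk0 : k 0 = g 0) : HasDerivWithinAt g q (Ici 0) 0 := by
  rw [hasDerivWithinAt_iff_tendsto_slope, Ici_sdiff_left] at *
  refine tendsto_of_tendsto_of_tendsto_of_le_of_le' hf hk ?_ ?_ <;>
  · filter_upwards [self_mem_nhdsWithin] with t ht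
    have ht : 0 < t := ht
    simp only [slope_def_field, sub_zero, hf0, hk0]
    gcongr
    first | exact hfg t ht | exact hgk t ht

variable {S Ω : Type*} [MeasurableSpace Ω]

lemma IsQMatrix.tendsto_mul_transition {P : S → Measure Ω} {X : ℝ → Ω → S} {Q : S → S → ℝ}
    (hQ : IsQMatrix P X Q) (i j : S) {t : ℝ}
    (ht : 0 < t) :
    Tendsto (fun m : ℕ => (m : ℝ) * (transition P X i j (t / m) - transition P X i j 0)) atTop
      (𝓝 (t * Q i j)) := by
  have h1 := hasDerivWithinAt_iff_tendsto_slope.1 (hQ i j)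
  rw [Ici_sdiff_left] at h1
  have h2 : Tendsto (fun m : ℕ => t / (m : ℝ)) atTop (𝓝[>] 0) := by
    refine tendsto_nhdsWithin_iff.2 ⟨tendsto_const_div_atTop_nhds_zero_nat t, ?_⟩
    filter_upwards [eventually_gt_atTop 0] with m hm
    have : (0 : ℝ) < m := by exact_mod_cast hm
    exact div_pos ht this
  refine ((h1.comp h2).const_mul t).congr' ?_
  filter_upwards [eventually_gt_atTop 0] with m hm
  have : (0 : ℝ) < m := by exact_mod_cast hm
  simp only [Function.comp, slope_def_field, sub_zero]
  field_simp

lemma pow_le_gridKernel (P : S → Measure Ω) (X : ℝ → Ω → S) {D : Set S} (h : ℝ) (n : ℕ) {j : S}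
    (hj : j ∉ D) : P j {ω | X h ω = j} ^ n ≤ gridKernel P X D h n j j := by
  induction n with
  | zero => simp [gridKernel, hj]
  | succ n ih =>
    simp only [gridKernel, indicator_of_mem (show j ∈ Dᶜ from hj)]
    refine le_trans ?_ (ENNReal.le_tsum j)
    rw [pow_succ']
    gcongr

variable [MeasurableSpace S] {P : S → Measure Ω} {X : ℝ → Ω → S} {Q : S → S → ℝ}

lemma IsMarkovChain.transition_zero [DecidableEq S] (hX : IsMarkovChain P X) (i j : S) :
    transition P X i j 0 = if i = j then 1 else 0 := by
  have := hX.isProbabilityMeasure i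
  have : {ω | X 0 ω = j} =ᵐ[P i] (if i = j then univ else ∅ : Set Ω) := by
    filter_upwards [hX.start i] with ω hω
    refine propext ?_
    change X 0 ω = j ↔ ω ∈ (if i = j then univ else ∅ : Set Ω)
    rw [hω]
    split_ifs with h <;> simp [h]
  rw [transition, measureReal_congr this]
  split_ifs <;> simp

lemma IsMarkovChain.aliveKernel_zero [DecidableEq S] (hX : IsMarkovChain P X) {D : Set S} {i : S}
    (hi : i ∉ D) (j : S) : (aliveKernel P X D 0 i j).toReal = if i = j then 1 else 0 := by
  rw [← hX.transition_zero, transition, measureReal_def, aliveKernel]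
  congr 1
  refine measure_congr ?_
  filter_upwards [hX.start i] with ω hω
  refine propext ⟨fun h => h.2, fun h => ⟨fun u hu => ?_, h⟩⟩
  obtain rfl : u = 0 := le_antisymm (by simpa using hu.2) hu.1
  rwa [hω]

lemma IsMarkovChain.aliveKernel_le (hX : IsMarkovChain P X) (D : Set S) (i j : S) (t : ℝ) :
    (aliveKernel P X D t i j).toReal ≤ transition P X i j t := by
  have := hX.isProbabilityMeasure i
  exact measureReal_mono inter_subset_right

/-- The chain on a grid can go from `i` to `j` by a single jump, at any of the `n` steps. -/
lemma IsMarkovChain.mul_pow_le_gridKernel (hX : IsMarkovChain P X) {D : Set S} (h : ℝ) (n : ℕ)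
    {i j : S} (hij : i ≠ j) (hi : i ∉ D) (hj : j ∉ D) :
    n * P i {ω | X h ω = j} * (P i {ω | X h ω = i} ^ n * P j {ω | X h ω = j} ^ n)
      ≤ gridKernel P X D h n i j := by
  classical
  have := hX.isProbabilityMeasure i
  have := hX.isProbabilityMeasure j
  induction n with
  | zero => simp
  | succ n ih =>
    simp only [gridKernel, indicator_of_mem (show i ∈ Dᶜ from hi)]
    refine le_trans ?_ (ENNReal.sum_le_tsum {i, j})
    rw [Finset.sum_pair hij]
    have hjj := pow_le_gridKernel P X h n hj
    set a := P i {ω | X h ω = i} with ha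
    set b := P j {ω | X h ω = j} with hb
    set c := P i {ω | X h ω = j} with hc
    have ha1 : a ^ (n + 1) ≤ 1 := pow_le_one₀ zero_le prob_le_one
    have hb1 : b ≤ 1 := prob_le_one
    calc ((n + 1 : ℕ) : ℝ≥0∞) * c * (a ^ (n + 1) * b ^ (n + 1))
        = a * (n * c * (a ^ n * b ^ n)) * b + c * (b ^ n * b) * a ^ (n + 1) := by
          push_cast; ring
      _ ≤ a * (n * c * (a ^ n * b ^ n)) * 1 + c * (b ^ n * 1) * 1 := by gcongr
      _ ≤ a * gridKernel P X D h n i j + c * gridKernel P X D h n j j := by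
          rw [mul_one, mul_one, mul_one]; gcongr

lemma tendsto_transition_pow (hX : IsMarkovChain P X) (hQ : IsQMatrix P X Q) (i : S) {t : ℝ}
    (ht : 0 < t) :
    Tendsto (fun n : ℕ => transition P X i i (t / 2 ^ n) ^ 2 ^ n) atTop
      (𝓝 (Real.exp (t * Q i i))) := by
  classical
  have h1 := (Real.tendsto_one_add_pow_exp_of_tendsto (hQ.tendsto_mul_transition i i ht)).comp
    tendsto_two_pow
  refine h1.congr fun n => ?_
  simp [Function.comp, hX.transition_zero]

variable [Countable S] [DiscreteMeasurableSpace S]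

lemma IsMarkovChain.tendsto_gridKernel_toReal (hX : IsMarkovChain P X) (D : Set S) (j k : S)
    {t : ℝ} (ht : 0 ≤ t) :
    Tendsto (fun n : ℕ => (gridKernel P X D (t / 2 ^ n) (2 ^ n) j k).toReal) atTop
      (𝓝 (aliveKernel P X D t j k).toReal) := by
  have := hX.isProbabilityMeasure j
  exact (ENNReal.tendsto_toReal (measure_ne_top _ _)).comp (hX.tendsto_gridKernel D j k ht)

lemma IsMarkovChain.gridKernel_ne_top (hX : IsMarkovChain P X) (D : Set S) {h : ℝ} (hh : 0 ≤ h)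
    (n : ℕ) (j k : S) : gridKernel P X D h n j k ≠ ∞ := by
  have := hX.isProbabilityMeasure j
  rw [hX.gridKernel_eq D hh]
  exact measure_ne_top _ _

/-- Survival in `j` is at least as likely as never jumping. -/
lemma IsMarkovChain.exp_le_aliveKernel (hX : IsMarkovChain P X) (hQ : IsQMatrix P X Q) {D : Set S}
    {j : S} (hj : j ∉ D) {t : ℝ} (ht : 0 < t) :
    Real.exp (t * Q j j) ≤ (aliveKernel P X D t j j).toReal := by
  refine le_of_tendsto_of_tendsto' (tendsto_transition_pow hX hQ j ht)
    (hX.tendsto_gridKernel_toReal D j j ht.le) fun n => ?_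
  have := ENNReal.toReal_mono (hX.gridKernel_ne_top D (by positivity) _ _ _)
    (pow_le_gridKernel P X (t / 2 ^ n) (2 ^ n) hj)
  rwa [ENNReal.toReal_pow] at this

/-- Going from `i` to `j` while avoiding `D` is at least as likely as doing so in a single jump. -/
lemma IsMarkovChain.mul_exp_le_aliveKernel (hX : IsMarkovChain P X) (hQ : IsQMatrix P X Q)
    {D : Set S} {i j : S} (hij : i ≠ j) (hi : i ∉ D) (hj : j ∉ D) {t : ℝ} (ht : 0 < t) :
    t * Q i j * (Real.exp (t * Q i i) * Real.exp (t * Q j j))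
      ≤ (aliveKernel P X D t i j).toReal := by
  classical
  have h1 := (hQ.tendsto_mul_transition i j ht).comp tendsto_two_pow
  refine le_of_tendsto_of_tendsto' (h1.mul ((tendsto_transition_pow hX hQ i ht).mul
    (tendsto_transition_pow hX hQ j ht)))
    (hX.tendsto_gridKernel_toReal D i j ht.le) fun n => ?_
  have := ENNReal.toReal_mono (hX.gridKernel_ne_top D (by positivity) _ _ _)
    (hX.mul_pow_le_gridKernel (t / 2 ^ n) (2 ^ n) hij hi hj)
  simp only [ENNReal.toReal_mul, ENNReal.toReal_pow] at this
  have h0 : transition P X i j 0 = 0 := by simp [hX.transition_zero, hij]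
  simp only [Function.comp, h0, sub_zero]
  simpa [transition, measureReal_def] using this

/-- Killing does not change the jump rates between states outside `D`: by the bounds above, the
killed transition probability lies between `p_{ij}(t)` and a minorant with the same slope. -/
theorem IsMarkovChain.hasDerivWithinAt_aliveKernel (hX : IsMarkovChain P X)
    (hQ : IsQMatrix P X Q) {D : Set S} {i j : S} (hi : i ∉ D) (hj : j ∉ D) :
    HasDerivWithinAt (fun t => (aliveKernel P X D t i j).toReal) (Q i j) (Ici 0) 0 := by
  classical
  by_cases hij : i = j
  · subst hij
    refine hasDerivWithinAt_zero_of_le_of_le (f := fun t => Real.exp (t * Q i i)) ?_ (hQ i i)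
      (fun t ht => hX.exp_le_aliveKernel hQ hi ht) (fun t _ => hX.aliveKernel_le D i i t) ?_ ?_
    · have := (((hasDerivAt_id (0 : ℝ)).mul_const (Q i i)).exp).hasDerivWithinAt (s := Ici 0)
      simpa using this
    · simp [hX.aliveKernel_zero hi]
    · simp [hX.aliveKernel_zero hi, hX.transition_zero]
  · refine hasDerivWithinAt_zero_of_le_of_le
      (f := fun t => t * Q i j * (Real.exp (t * Q i i) * Real.exp (t * Q j j))) ?_ (hQ i j)
      (fun t ht => hX.mul_exp_le_aliveKernel hQ hij hi hj ht)
      (fun t _ => hX.aliveKernel_le D i j t) ?_ ?_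
    · have h := fun a : ℝ => (hasDerivAt_id (0 : ℝ)).mul_const a
      have := ((h (Q i j)).fun_mul ((h (Q i i)).exp.fun_mul (h (Q j j)).exp)).hasDerivWithinAt
        (s := Ici 0)
      simpa using this
    · simp [hX.aliveKernel_zero hi, hij]
    · simp [hX.aliveKernel_zero hi, hX.transition_zero, hij]

end DerivativeAtZero

/-! ### The transition function of the killed chain and its `q`-matrix -/

lemma hasSum_option {α : Type*} {f : Option α → ℝ} {a : ℝ} (h : HasSum (fun i => f (some i)) a) :
    HasSum f (f none + a) := by
  classical
  have h1 : HasSum (fun i => if i = none then 0 else f i) a :=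
    ((Option.some_injective α).hasSum_iff (fun x hx => by
      rw [if_pos]
      cases x with
      | none => rfl
      | some y => exact absurd ⟨y, rfl⟩ hx)).1 (by simpa [Function.comp_def] using h)
  convert (hasSum_ite_eq none (f none)).add h1 using 1
  funext i
  cases i <;> simp

lemma hasSum_toReal {ι : Type*} {f : ι → ℝ≥0∞} {a : ℝ≥0∞} (ha : a ≠ ∞) (h : a = ∑' i, f i) :
    HasSum (fun i => (f i).toReal) a.toReal := by
  subst h
  rw [ENNReal.tsum_toReal_eq (ENNReal.ne_top_of_tsum_ne_top ha)]
  exact ENNReal.hasSum_toReal ha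

lemma tendsto_div_of_hasDerivWithinAt {f : ℝ → ℝ} {q : ℝ} (h : HasDerivWithinAt f q (Ici 0) 0) :
    Tendsto (fun t => (f t - f 0) / t) (𝓝[>] 0) (𝓝 q) := by
  rw [hasDerivWithinAt_iff_tendsto_slope, Ici_sdiff_left] at h
  exact h.congr fun t => by simp [slope_def_field]

section KilledTransition

variable {S : Type*} {Q : S → S → ℝ} {D : Set S}

lemma hasSum_killingRate (hcons : IsConservative Q) (i : Alive D) :
    HasSum (fun j : D => Q i j) (killingRate Q D i) :=
  ((hcons i).summable.subtype D).hasSum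

lemma hasSum_alive_rate (hcons : IsConservative Q) (i : Alive D) :
    HasSum (fun j : Alive D => Q i j) (-killingRate Q D i) := by
  have h1 := (hasSum_killingRate (D := D) hcons i)
  have h2 : HasSum (fun j : ↥(Dᶜ) => Q i j) (∑' j : ↥(Dᶜ), Q i j) :=
    ((hcons i).summable.subtype Dᶜ).hasSum
  have h3 := (h1.add_compl h2).unique (hcons i)
  rw [← eq_neg_of_add_eq_zero_right h3]
  exact h2

lemma hasSum_killedQ (hcons : IsConservative Q) (i : AliveΔ D) : HasSum (killedQ Q D i) 0 := by
  cases i with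
  | none => exact hasSum_zero
  | some i =>
    have := hasSum_option (f := killedQ Q D (some i)) (hasSum_alive_rate hcons i)
    simpa [killedQ] using this

variable {Ω : Type*} [MeasurableSpace Ω]

lemma killedTransition_nonneg (P : S → Measure Ω) (X : ℝ → Ω → S) (D : Set S) (i j : AliveΔ D)
    (t : ℝ) : 0 ≤ killedTransition P X D i j t := by
  cases i with
  | none => rw [killedTransition]; split_ifs <;> norm_num
  | some i => exact measureReal_nonneg

lemma hasSum_aliveKernel_mul (P : S → Measure Ω) (X : ℝ → Ω → S) (i : Alive D) {t : ℝ}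
    (ht : 0 ≤ t) {g : S → ℝ≥0∞} {a : ℝ≥0∞} (ha : a ≠ ∞)
    (hsum : a = ∑' l, aliveKernel P X D t i l * g l) :
    HasSum (fun k : Alive D => (aliveKernel P X D t i k * g k).toReal) a.toReal := by
  refine ((Subtype.val_injective (p := fun k => k ∉ D)).hasSum_iff
    (f := fun l => (aliveKernel P X D t i l * g l).toReal) (fun l hl => ?_)).2
    (hasSum_toReal ha hsum)
  have : l ∈ D := by
    by_contra h
    exact hl ⟨⟨l, h⟩, rfl⟩
  simp [aliveKernel_of_mem P X ht _ this]

variable [MeasurableSpace S] {P : S → Measure Ω} {X : ℝ → Ω → S}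

lemma IsMarkovChain.killedTransition_le_one (hX : IsMarkovChain P X) (i j : AliveΔ D)
    (t : ℝ) : killedTransition P X D i j t ≤ 1 := by
  cases i with
  | none => rw [killedTransition]; split_ifs <;> norm_num
  | some i =>
    have := hX.isProbabilityMeasure i
    exact measureReal_le_one

lemma IsMarkovChain.killed_eq_none_iff (hX : IsMarkovChain P X) {t : ℝ} (ht : 0 ≤ t) (ω : Ω) :
    killed X D t ω = none ↔ ω ∉ avoids X D 0 t := by
  rw [← mem_survival_iff D hX.right_continuous ht, killed]
  split_ifs with h
  · simp [h.2]
  · simpa [ht] using h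

lemma IsMarkovChain.killed_eq_some_iff (hX : IsMarkovChain P X) {t : ℝ} (ht : 0 ≤ t)
    (k : Alive D) (ω : Ω) :
    killed X D t ω = some k ↔ ω ∈ avoids X D 0 t ∧ X t ω = k := by
  rw [← mem_survival_iff D hX.right_continuous ht, killed]
  split_ifs with h
  · simp [h.2, Subtype.ext_iff]
  · have : ω ∉ survival X D t := by simpa [ht] using h
    simp [this]

lemma IsMarkovChain.killedTransition_some_some (hX : IsMarkovChain P X) {t : ℝ} (ht : 0 ≤ t)
    (i k : Alive D) :
    killedTransition P X D (some i) (some k) t = (aliveKernel P X D t i k).toReal := by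
  rw [killedTransition, measureReal_def, aliveKernel]
  congr 2
  ext ω
  exact hX.killed_eq_some_iff ht k ω

/-- Sums over `S` against the kernel `P_i(T > t, X_t = ·)` as sums over `E_Δ` against the
`i`-th row of `P^T(t)`. -/
lemma IsMarkovChain.hasSum_killedTransition_mul (hX : IsMarkovChain P X) (i : Alive D) {t : ℝ}
    (ht : 0 ≤ t) {g : S → ℝ≥0∞} {a : ℝ≥0∞} (ha : a ≠ ∞)
    (hsum : a = ∑' l, aliveKernel P X D t i l * g l) {G : AliveΔ D → ℝ} (hG : G none = 0)
    (hGg : ∀ k : Alive D, G (some k) = (g k).toReal) :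
    HasSum (fun k => killedTransition P X D (some i) k t * G k) a.toReal := by
  have h := hasSum_aliveKernel_mul P X i ht ha hsum
  simp only [ENNReal.toReal_mul, ← hX.killedTransition_some_some ht, ← hGg] at h
  simpa [hG] using hasSum_option (f := fun k => killedTransition P X D (some i) k t * G k) h

variable [DiscreteMeasurableSpace S]

lemma IsMarkovChain.killedTransition_some_none (hX : IsMarkovChain P X) {t : ℝ} (ht : 0 ≤ t)
    (i : Alive D) :
    killedTransition P X D (some i) none t = 1 - (P i (avoids X D 0 t)).toReal := by
  have := hX.isProbabilityMeasure i
  rw [killedTransition, ← measureReal_def,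
    ← probReal_compl_eq_one_sub (hX.measurableSet_avoids D le_rfl ht)]
  congr 1
  ext ω
  exact hX.killed_eq_none_iff ht ω

lemma IsMarkovChain.measurableSet_killed_eq (hX : IsMarkovChain P X) {t : ℝ} (ht : 0 ≤ t)
    (j : AliveΔ D) : MeasurableSet {ω | killed X D t ω = j} := by
  cases j with
  | none =>
    simp only [hX.killed_eq_none_iff ht]
    exact (hX.measurableSet_avoids D le_rfl ht).compl
  | some k =>
    simp only [hX.killed_eq_some_iff ht]
    exact (hX.measurableSet_avoids D le_rfl ht).inter (hX.measurableSet_eq ht k)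

lemma IsMarkovChain.killedTransition_zero [DecidableEq S] (hX : IsMarkovChain P X)
    (i j : AliveΔ D) : killedTransition P X D i j 0 = if i = j then 1 else 0 := by
  cases i with
  | none => simp [killedTransition, eq_comm]
  | some i =>
    cases j with
    | some j =>
      simp [hX.killedTransition_some_some le_rfl, hX.aliveKernel_zero i.2, Subtype.ext_iff]
    | none =>
      have := hX.isProbabilityMeasure i
      have h : P i (avoids X D 0 0) = 1 := by
        rw [← hX.measure_start i]
        refine measure_congr ?_
        filter_upwards [hX.start i] with ω hω
        refine propext ⟨fun _ => ⟨mem_univ _, hω⟩, fun _ u hu => ?_⟩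
        obtain rfl : u = 0 := le_antisymm (by simpa using hu.2) hu.1
        rw [hω]
        exact i.2
      simp [hX.killedTransition_some_none le_rfl, h]

variable [Countable S]

lemma IsMarkovChain.hasSum_killedTransition (hX : IsMarkovChain P X) (i : AliveΔ D) {t : ℝ}
    (ht : 0 ≤ t) : HasSum (fun j => killedTransition P X D i j t) 1 := by
  classical
  cases i with
  | none => exact hasSum_ite_eq none 1
  | some i =>
    have := hX.isProbabilityMeasure i
    have h := measure_eq_tsum_fiber (P i) (hX.measurableSet_killed_eq (D := D) ht)
      MeasurableSet.univ
    simp only [univ_inter, measure_univ] at h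
    exact hasSum_toReal ENNReal.one_ne_top h

/-- The Chapman-Kolmogorov equation for the killed chain on `E_Δ`. -/
theorem IsMarkovChain.killedTransition_add (hX : IsMarkovChain P X) (i j : AliveΔ D) {s t : ℝ}
    (hs : 0 ≤ s) (ht : 0 ≤ t) :
    killedTransition P X D i j (s + t)
      = ∑' k, killedTransition P X D i k s * killedTransition P X D k j t := by
  classical
  cases i with
  | none =>
    rw [tsum_eq_single none (fun k hk => by simp [killedTransition, hk])]
    simp [killedTransition]
  | some i =>
    have := hX.isProbabilityMeasure i
    cases j with
    | some j =>
      refine ((hX.hasSum_killedTransition_mul i hs (measure_ne_top (P i) _)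
        (hX.aliveKernel_add D hs ht i j) ?_ fun k => ?_).tsum_eq.trans ?_).symm
      · simp [killedTransition]
      · exact hX.killedTransition_some_some ht k j
      · exact (hX.killedTransition_some_some (add_nonneg hs ht) i j).symm
    | none =>
      have h1 := hX.hasSum_killedTransition_mul i hs (measure_ne_top (P i) _)
        (hX.measure_avoids_add D hs ht i) (G := fun k => 1 - killedTransition P X D k none t)
        (by simp [killedTransition]) (fun k => by
          simp [hX.killedTransition_some_none ht])
      have h2 := (hX.hasSum_killedTransition (some i) hs).sub h1
      rw [hX.killedTransition_some_none (add_nonneg hs ht), ← h2.tsum_eq]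
      exact tsum_congr fun k => by ring

/-- The killing rate is the derivative of `P_i(T ≤ t)` at `0`: the probability is bounded below by
`P_i(X_t ∈ F)` for finite `F ⊆ D`, and above by `P_i(not (T > t, X_t ∈ F))` for finite `F ⊆ E`;
by conservativity, the slopes of both bounds approach `η_i` as `F` grows. -/
lemma IsMarkovChain.hasDerivWithinAt_killedTransition_none (hX : IsMarkovChain P X)
    (hQ : IsQMatrix P X Q) (hcons : IsConservative Q) (i : Alive D) :
    HasDerivWithinAt (killedTransition P X D (some i) none) (killingRate Q D i) (Ici 0) 0 := by
  classical
  have := hX.isProbabilityMeasure i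
  rw [hasDerivWithinAt_iff_tendsto_slope, Ici_sdiff_left]
  have hz : killedTransition P X D (some i) none 0 = 0 := by simp [hX.killedTransition_zero]
  refine tendsto_order.2 ⟨fun a ha => ?_, fun a ha => ?_⟩
  · obtain ⟨F, hF⟩ := ((hasSum_killingRate hcons i).eventually_const_lt ha).exists
    have hlim : Tendsto (fun t => (∑ j ∈ F, (transition P X i j t - transition P X i j 0) / t))
        (𝓝[>] 0) (𝓝 (∑ j ∈ F, Q i j)) :=
      tendsto_finsetSum _ fun j _ => tendsto_div_of_hasDerivWithinAt (hQ i j)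
    filter_upwards [hlim.eventually_const_lt hF, self_mem_nhdsWithin] with t ht hpos
    have hpos : 0 < t := hpos
    refine ht.trans_le ?_
    rw [slope_def_field, hz, sub_zero, sub_zero, ← Finset.sum_div]
    gcongr
    have h0 : ∀ j ∈ F, transition P X i j t - transition P X i j 0 = transition P X i j t :=
      fun j _ => by
        have : (i : S) ≠ j := fun h => i.2 (h ▸ j.2)
        simp [hX.transition_zero, this]
    rw [Finset.sum_congr rfl h0]
    unfold transition
    rw [← measureReal_biUnion_finset]
    · refine measureReal_mono fun ω hω => ?_
      rw [mem_ofPred_eq, hX.killed_eq_none_iff hpos.le]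
      simp only [mem_iUnion] at hω
      obtain ⟨j, -, hj⟩ := hω
      have hj : X t ω = j := hj
      exact fun h => h t ⟨hpos.le, by simp⟩ (hj ▸ j.2)
    · intro a _ b _ hab
      exact Set.disjoint_left.2 fun ω h1 h2 => hab (Subtype.ext (h1.symm.trans h2))
    · exact fun j _ => hX.measurableSet_eq hpos.le j
  · obtain ⟨F, hF, hiF⟩ := (((hasSum_alive_rate hcons i).eventually_const_lt
      (neg_lt_neg ha)).and (eventually_ge_atTop {i})).exists
    -- `F` has to contain `i` for the upper bound to vanish at time `0`
    have hiF : i ∈ F := hiF (Finset.mem_singleton_self i)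
    have hlim : Tendsto (fun t => (∑ j ∈ F, ((aliveKernel P X D t i j).toReal -
        (aliveKernel P X D 0 i j).toReal) / t)) (𝓝[>] 0) (𝓝 (∑ j ∈ F, Q i j)) :=
      tendsto_finsetSum _ fun j _ =>
        tendsto_div_of_hasDerivWithinAt (hX.hasDerivWithinAt_aliveKernel hQ i.2 j.2)
    filter_upwards [hlim.eventually_const_lt hF, self_mem_nhdsWithin] with t ht hpos
    have hpos : 0 < t := hpos
    refine lt_of_le_of_lt ?_ (neg_lt_neg ht |>.trans_eq (neg_neg a))
    rw [slope_def_field, hz, sub_zero, sub_zero, ← Finset.sum_div, ← neg_div]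
    gcongr
    have h0 : ∑ j ∈ F, (aliveKernel P X D 0 i j).toReal = 1 := by
      simp [hX.aliveKernel_zero i.2, ← Subtype.ext_iff, hiF]
    rw [Finset.sum_sub_distrib, h0]
    have h1 := hasSum_aliveKernel_mul P X i hpos.le (g := fun _ => 1) (measure_ne_top _ _)
      (by simpa using (hX.tsum_aliveKernel D hpos.le i).symm)
    simp only [mul_one] at h1
    rw [hX.killedTransition_some_none hpos.le]
    linarith [sum_le_hasSum F (fun j _ => ENNReal.toReal_nonneg) h1]

theorem IsMarkovChain.hasDerivWithinAt_killedTransition_zero (hX : IsMarkovChain P X)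
    (hQ : IsQMatrix P X Q) (hcons : IsConservative Q) (i j : AliveΔ D) :
    HasDerivWithinAt (killedTransition P X D i j) (killedQ Q D i j) (Ici 0) 0 := by
  cases i with
  | none => exact hasDerivWithinAt_const _ _ _
  | some i =>
    cases j with
    | none => exact hX.hasDerivWithinAt_killedTransition_none hQ hcons i
    | some j =>
      exact (hX.hasDerivWithinAt_aliveKernel hQ i.2 j.2).congr
        (fun t ht => hX.killedTransition_some_some ht i j)
        (hX.killedTransition_some_some le_rfl i j)

/-- The backward equation for the killed chain. -/
theorem IsMarkovChain.hasDerivWithinAt_killedTransition (hX : IsMarkovChain P X)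
    (hQ : IsQMatrix P X Q) (hcons : IsConservative Q) (i j : AliveΔ D) {t : ℝ} (ht : 0 ≤ t) :
    HasDerivWithinAt (killedTransition P X D i j)
      (∑' k, killedQ Q D i k * killedTransition P X D k j t) (Ici 0) t := by
  classical
  refine hasDerivWithinAt_backward (p := killedTransition P X D)
    (u := fun k => killedTransition P X D k j) (fun i k t _ => killedTransition_nonneg P X D i k t)
    (fun i t => hX.hasSum_killedTransition i) (fun i k hk => ?_)
    (hX.hasDerivWithinAt_killedTransition_zero hQ hcons) (hasSum_killedQ hcons) (fun k s _ => ?_)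
    (fun i h s hh hs => hX.killedTransition_add i j hh hs) i ht
  · simp [hX.killedTransition_zero, hk.symm]
  · rw [abs_of_nonneg (killedTransition_nonneg P X D k j s)]
    exact hX.killedTransition_le_one k j s

end KilledTransition

/-! ### The chain started from `μ` -/

/-- A function on `[0, ∞)`, continuous and with `f' = -α f` on `(0, ∞)`, is `f(0) e^{-αt}`. -/
lemma eq_mul_exp_of_hasDerivWithinAt {α : ℝ} {f : ℝ → ℝ} (hc : ContinuousOn f (Ici 0))
    (hd : ∀ t, 0 < t → HasDerivWithinAt f (-α * f t) (Ici 0) t) {t : ℝ} (ht : 0 ≤ t) :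
    f t = f 0 * Real.exp (-α * t) := by
  rcases ht.eq_or_lt with rfl | ht
  · simp
  have hcont : ContinuousOn (fun s => Real.exp (α * s) * f s) (Icc 0 t) :=
    (by fun_prop : Continuous fun s => Real.exp (α * s)).continuousOn.mul
      (hc.mono Icc_subset_Ici_self)
  obtain ⟨c, -, h⟩ := exists_hasDerivAt_eq_slope (fun s => Real.exp (α * s) * f s) (fun _ => 0) ht
    hcont (fun s hs => by
      have h1 := (hd s hs.1).hasDerivAt (Ici_mem_nhds hs.1)
      have h2 := ((hasDerivAt_id s).const_mul α).exp
      refine (h2.fun_mul h1).congr_deriv ?_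
      simp only [id]
      ring)
  rw [eq_comm, div_eq_zero_iff, sub_zero, or_iff_left ht.ne', sub_eq_zero] at h
  have hinv : Real.exp (α * t) * Real.exp (-α * t) = 1 := by
    rw [← Real.exp_add]; simp
  simp only [mul_zero, Real.exp_zero, one_mul] at h
  rw [← h]
  linear_combination (-f t) * hinv

section InitialLaw

variable {S Ω : Type*} [MeasurableSpace S]
  [MeasurableSpace Ω] {P : S → Measure Ω} {X : ℝ → Ω → S} {Q : S → S → ℝ} {D : Set S}
  {μ : AliveΔ D → ℝ} {α : ℝ}

lemma IsDistribution.hasSum_initialLaw (hX : IsMarkovChain P X) (hμ : IsDistribution μ)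
    {B : Set Ω} (hB : MeasurableSet B) :
    HasSum (fun i : Alive D => μ (some i) * (P i).real B) ((initialLaw P μ).real B) := by
  have hP := hX.isProbabilityMeasure
  have h1 : HasSum (fun i : Alive D => μ (some i)) 1 := by
    refine ((Option.some_injective _).hasSum_iff fun x hx => ?_).2 hμ.hasSum
    cases x with
    | none => exact hμ.cemetery
    | some x => exact absurd ⟨x, rfl⟩ hx
  have h2 : initialLaw P μ B = ∑' i : Alive D, ENNReal.ofReal (μ (some i)) * P i B := by
    rw [initialLaw, Measure.sum_apply _ hB]
    rfl
  have h3 : ∑' i : Alive D, ENNReal.ofReal (μ (some i)) * P i B ≠ ∞ := by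
    refine ne_top_of_le_ne_top (b := ∑' i : Alive D, ENNReal.ofReal (μ (some i))) ?_
      (ENNReal.tsum_le_tsum fun i => mul_le_of_le_one_right zero_le prob_le_one)
    rw [← ENNReal.ofReal_tsum_of_nonneg (fun i => hμ.nonneg _) h1.summable]
    exact ENNReal.ofReal_ne_top
  have h4 := hasSum_toReal (h2 ▸ h3) h2
  simpa only [measureReal_def, ENNReal.toReal_mul, ENNReal.toReal_ofReal (hμ.nonneg _)] using h4

variable [DiscreteMeasurableSpace S]

lemma IsDistribution.hasSum_mulTransition (hX : IsMarkovChain P X) (hμ : IsDistribution μ)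
    (j : AliveΔ D) {t : ℝ} (ht : 0 ≤ t) :
    HasSum (fun i => μ i * killedTransition P X D i j t)
      ((initialLaw P μ).real {ω | killed X D t ω = j}) := by
  have := hasSum_option (f := fun i => μ i * killedTransition P X D i j t)
    (hμ.hasSum_initialLaw hX (hX.measurableSet_killed_eq ht j))
  simpa [hμ.cemetery] using this

lemma IsDistribution.mulTransition_eq (hX : IsMarkovChain P X) (hμ : IsDistribution μ)
    (j : AliveΔ D) {t : ℝ} (ht : 0 ≤ t) :
    mulTransition P X D μ j t = (initialLaw P μ).real {ω | killed X D t ω = j} :=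
  (hμ.hasSum_mulTransition hX j ht).tsum_eq

lemma IsMarkovChain.conditionalLaw_none (hX : IsMarkovChain P X) (μ : AliveΔ D → ℝ) {t : ℝ}
    (ht : 0 ≤ t) : conditionalLaw P X D μ none t = 0 := by
  rw [conditionalLaw, measureReal_def, cond_apply' (hX.measurableSet_killed_eq ht none)]
  have : survival X D t ∩ {ω | killed X D t ω = none} = ∅ := by
    ext ω
    simp [hX.killed_eq_none_iff ht, mem_survival_iff D hX.right_continuous ht]
  simp [this]

lemma IsDistribution.mulTransition_none_zero (hX : IsMarkovChain P X) (hμ : IsDistribution μ) :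
    mulTransition P X D μ none 0 = 0 := by
  classical
  rw [mulTransition, tsum_eq_single none (fun i hi => by simp [hX.killedTransition_zero, hi]),
    hμ.cemetery, zero_mul]

/-- `P_μ(T > t) = 1 - (μ P^T(t))_Δ`. -/
lemma IsDistribution.survival_eq (hX : IsMarkovChain P X) (hμ : IsDistribution μ) {t : ℝ}
    (ht : 0 ≤ t) :
    (initialLaw P μ).real (survival X D t) = 1 - mulTransition P X D μ none t := by
  have hP := hX.isProbabilityMeasure
  have hset : survival X D t = avoids X D 0 t := by
    ext ω; exact mem_survival_iff D hX.right_continuous ht ω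
  have h1 := hμ.hasSum.sub (hμ.hasSum_mulTransition hX none ht)
  have h2 := hasSum_option (f := fun i => μ i - μ i * killedTransition P X D i none t)
    (a := (initialLaw P μ).real (survival X D t)) (by
      have := hμ.hasSum_initialLaw hX (hX.measurableSet_avoids D le_rfl ht)
      rw [← hset] at this
      convert this using 2 with i
      rw [hX.killedTransition_some_none ht, hset, measureReal_def]
      ring)
  rw [hμ.mulTransition_eq hX none ht, h1.unique h2]
  simp [hμ.cemetery]

/-- If `P_μ(T > t) = 0`, both sides are `0` by the conventions for `0⁻¹` and for conditioning on a
null event. -/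
lemma IsDistribution.conditionalLaw_some (hX : IsMarkovChain P X) (hμ : IsDistribution μ)
    (j : Alive D) {t : ℝ} (ht : 0 ≤ t) :
    conditionalLaw P X D μ (some j) t
      = ((initialLaw P μ).real (survival X D t))⁻¹ * mulTransition P X D μ (some j) t := by
  rw [conditionalLaw, measureReal_def, cond_apply' (hX.measurableSet_killed_eq ht _),
    hμ.mulTransition_eq hX _ ht]
  have : survival X D t ∩ {ω | killed X D t ω = some j} = {ω | killed X D t ω = some j} := by
    ext ω
    simp only [hX.killed_eq_some_iff ht, mem_survival_iff D hX.right_continuous ht, mem_inter_iff,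
      mem_ofPred_eq]
    tauto
  rw [this, ENNReal.toReal_mul, ENNReal.toReal_inv]
  rfl

lemma IsDistribution.mulTransition_sub (hX : IsMarkovChain P X) (hμ : IsDistribution μ)
    (j : AliveΔ D) {t : ℝ} (ht : 0 ≤ t) :
    mulTransition P X D (fun i => μ i - cemeteryDelta D i) j t
      = mulTransition P X D μ j t - cemeteryDelta D j := by
  classical
  have h1 := hμ.hasSum_mulTransition hX j ht
  have h2 : HasSum (fun i => cemeteryDelta D i * killedTransition P X D i j t)
      (cemeteryDelta D j) := by
    have := hasSum_single (f := fun i => cemeteryDelta D i * killedTransition P X D i j t) none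
      (fun i hi => by
        cases i with
        | none => exact absurd rfl hi
        | some i => simp [cemeteryDelta])
    convert this using 1
    cases j <;> simp [cemeteryDelta, killedTransition]
  have h3 := h1.sub h2
  simp only [← sub_mul] at h3
  rw [mulTransition, h3.tsum_eq, hμ.mulTransition_eq hX j ht]

/-- If `T` is exponential under `P_μ`, then `μ_j(t) = e^{αt} (μ P^T(t))_j` for `j ∈ E`, so that the
product rule translates between the derivatives of `μ P^T(t)` and of `μ(t)`. The coordinate `Δ` of
either side is explicit. -/
lemma IsExponential.hasDerivWithinAt_iff (hX : IsMarkovChain P X) (hμ : IsDistribution μ)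
    (hexp : IsExponential P X D μ α) (j : AliveΔ D) {t : ℝ} (ht : 0 ≤ t) (d : ℝ) :
    HasDerivWithinAt (mulTransition P X D μ j) d (Ici 0) t ↔
      HasDerivWithinAt (conditionalLaw P X D μ j) (Real.exp (α * t) *
        (d + α * mulTransition P X D (fun i => μ i - cemeteryDelta D i) j t)) (Ici 0) t := by
  have hut := uniqueDiffOn_Ici (0 : ℝ) t ht
  have hE : ∀ a : ℝ, HasDerivWithinAt (fun s => Real.exp (a * s)) (a * Real.exp (a * t))
      (Ici 0) t := fun a => by
    have := (((hasDerivAt_id t).const_mul a).exp).hasDerivWithinAt (s := Ici 0)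
    simpa [mul_comm] using this
  have hinv : Real.exp (α * t) * Real.exp (-α * t) = 1 := by
    rw [← Real.exp_add]; simp
  rw [hμ.mulTransition_sub hX j ht]
  cases j with
  | none =>
    have hu : ∀ s, 0 ≤ s → mulTransition P X D μ none s = 1 - Real.exp (-α * s) := fun s hs => by
      rw [← hexp s hs, hμ.survival_eq hX hs]; ring
    have hc : HasDerivWithinAt (conditionalLaw P X D μ none) 0 (Ici 0) t :=
      (hasDerivWithinAt_const t _ (0 : ℝ)).congr (fun s hs => hX.conditionalLaw_none μ hs)
        (hX.conditionalLaw_none μ ht)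
    have hm : HasDerivWithinAt (mulTransition P X D μ none) (α * Real.exp (-α * t)) (Ici 0) t := by
      have := ((hE (-α)).const_sub 1).congr (fun s hs => hu s hs) (hu t ht)
      simpa using this
    rw [hu t ht, cemeteryDelta]
    constructor
    · intro h
      have hd := hut.eq_deriv _ h hm
      convert hc using 1
      rw [hd]; ring
    · intro h
      have h0 := hut.eq_deriv _ h hc
      have hd : d = α * Real.exp (-α * t) := by
        have := (mul_eq_zero.1 h0).resolve_left (Real.exp_pos _).ne'
        linarith
      rw [hd]; exact hm
  | some j =>
    have hc : ∀ s, 0 ≤ s → conditionalLaw P X D μ (some j) s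
        = Real.exp (α * s) * mulTransition P X D μ (some j) s := fun s hs => by
      rw [hμ.conditionalLaw_some hX j hs, hexp s hs, ← Real.exp_neg]
      congr 2; ring
    have hu : ∀ s, 0 ≤ s → mulTransition P X D μ (some j) s
        = Real.exp (-α * s) * conditionalLaw P X D μ (some j) s := fun s hs => by
      rw [hc s hs, ← mul_assoc, ← Real.exp_add]; simp
    rw [cemeteryDelta, sub_zero]
    constructor
    · intro h
      refine (((hE α).fun_mul h).congr (fun s hs => hc s hs) (hc t ht)).congr_deriv ?_
      ring
    · intro h
      refine (((hE (-α)).fun_mul h).congr (fun s hs => hu s hs) (hu t ht)).congr_deriv ?_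
      rw [hc t ht]
      linear_combination d * hinv

/-- The coordinate `Δ` of the equation for the conditional law: as `μ_Δ(t) = 0`, it determines the
coordinate `Δ` of `μ Q^T P^T(t)`. -/
lemma ConditionalLawEquation.hasSum_none (hX : IsMarkovChain P X) (hμ : IsDistribution μ)
    {J : Set ℝ} (hJ : J ⊆ Ici 0) (h : ConditionalLawEquation P X Q D μ α J) {t : ℝ} (ht : t ∈ J) :
    HasSum (fun i => μ i * ∑' k, killedQ Q D i k * killedTransition P X D k none t)
      (α * (1 - mulTransition P X D μ none t)) := by
  have ht0 : 0 ≤ t := hJ ht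
  obtain ⟨d, hd, hc⟩ := h none t ht
  have hc0 : HasDerivWithinAt (conditionalLaw P X D μ none) 0 (Ici 0) t :=
    (hasDerivWithinAt_const t _ (0 : ℝ)).congr (fun s hs => hX.conditionalLaw_none μ hs)
      (hX.conditionalLaw_none μ ht0)
  have h0 := (uniqueDiffOn_Ici (0 : ℝ) t ht0).eq_deriv _ hc hc0
  have h1 := (mul_eq_zero.1 h0).resolve_left (Real.exp_pos _).ne'
  rw [hμ.mulTransition_sub hX none ht0, cemeteryDelta] at h1
  convert hd using 1
  linarith

variable [Countable S]

/-- By the backward equation, differentiating `μ P^T(t)` term by term yields `μ Q^T P^T(t)`. -/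
lemma IsMarkovChain.differentiabilityCondition_iff (hX : IsMarkovChain P X) (hQ : IsQMatrix P X Q)
    (hcons : IsConservative Q) {J : Set ℝ} (hJ : J ⊆ Ici 0) :
    DifferentiabilityCondition P X D μ J ↔ ∀ j : AliveΔ D, ∀ t ∈ J,
      ∃ d : ℝ, HasSum (fun i => μ i * ∑' k, killedQ Q D i k * killedTransition P X D k j t) d ∧
        HasDerivWithinAt (mulTransition P X D μ j) d (Ici 0) t := by
  refine forall_congr' fun j => forall₂_congr fun t htJ => ?_
  have ht : 0 ≤ t := hJ htJ
  have hd := fun i => hX.hasDerivWithinAt_killedTransition hQ hcons (D := D) i j ht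
  have hd' : ∀ i, derivWithin (killedTransition P X D i j) (Ici 0) t = _ :=
    fun i => (hd i).derivWithin (uniqueDiffOn_Ici 0 t ht)
  simp only [hd']
  exact and_iff_right fun i => (hd i).differentiableWithinAt

lemma IsDistribution.continuousOn_mulTransition (hX : IsMarkovChain P X) (hQ : IsQMatrix P X Q)
    (hcons : IsConservative Q) (hμ : IsDistribution μ) (j : AliveΔ D) :
    ContinuousOn (mulTransition P X D μ j) (Ici 0) := by
  refine continuousOn_tsum (fun i t ht => ?_) hμ.hasSum.summable (fun i t _ => ?_)
  · exact ((hX.hasDerivWithinAt_killedTransition hQ hcons i j ht).continuousWithinAt).const_mul _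
  · rw [Real.norm_of_nonneg (mul_nonneg (hμ.nonneg i) (killedTransition_nonneg P X D i j t))]
    exact mul_le_of_le_one_right (hμ.nonneg i) (hX.killedTransition_le_one i j t)

end InitialLaw

end KilledChain

end

open KilledChain in
theorem theorem1 {S Ω : Type*} [Countable S] [MeasurableSpace S] [DiscreteMeasurableSpace S]
    [MeasurableSpace Ω] (P : S → Measure Ω) (X : ℝ → Ω → S) (Q : S → S → ℝ)
    (hX : IsMarkovChain P X) (hirr : IsIrreducible P X) (hQ : IsQMatrix P X Q)
    (hcons : IsConservative Q) (D : Set S) (μ : AliveΔ D → ℝ) (hμ : IsDistribution μ)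
    (α : ℝ) (hα : 0 < α) :
    (∀ J : Set ℝ, J = Ioi 0 ∨ J = Ici 0 →
      (DifferentiabilityCondition P X D μ J →
        (IsExponential P X D μ α ↔ ConditionalLawEquation P X Q D μ α J)) ∧
      (IsExponential P X D μ α →
        (DifferentiabilityCondition P X D μ J ↔ ConditionalLawEquation P X Q D μ α J))) ∧
    (ConditionalLawEquation P X Q D μ α (Ici 0) →
      HasSum (fun i : Alive D => killingRate Q D i * μ (some i)) α) := by
  refine ⟨fun J hJ => ?_, fun h => ?_⟩
  · have hJ0 : J ⊆ Ici 0 := by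
      rcases hJ with rfl | rfl
      exacts [Ioi_subset_Ici_self, Subset.rfl]
    have hJ1 : Ioi 0 ⊆ J := by
      rcases hJ with rfl | rfl
      exacts [Subset.rfl, Ioi_subset_Ici_self]
    have hii : IsExponential P X D μ α →
        (DifferentiabilityCondition P X D μ J ↔ ConditionalLawEquation P X Q D μ α J) :=
      fun hexp => by
        rw [hX.differentiabilityCondition_iff hQ hcons hJ0]
        exact forall_congr' fun j => forall₂_congr fun t ht => exists_congr fun d =>
          and_congr_right fun _ => hexp.hasDerivWithinAt_iff hX hμ j (hJ0 ht) d
    refine ⟨fun hD => ⟨fun hexp => (hii hexp).1 hD, fun hO t ht => ?_⟩, hii⟩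
    rw [hX.differentiabilityCondition_iff hQ hcons hJ0] at hD
    -- the survival function solves `f' = -α f` on `(0, ∞)`
    have hsol := eq_mul_exp_of_hasDerivWithinAt (α := α)
      (f := fun t => 1 - mulTransition P X D μ none t)
      (continuousOn_const.sub (hμ.continuousOn_mulTransition hX hQ hcons none))
      (fun s hs => by
        obtain ⟨d, hd, hder⟩ := hD none s (hJ1 hs)
        rw [hd.unique (hO.hasSum_none hX hμ hJ0 (hJ1 hs))] at hder
        exact (hder.const_sub 1).congr_deriv (by ring)) ht
    rw [hμ.survival_eq hX ht, hsol, hμ.mulTransition_none_zero hX]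
    ring
  · classical
    have h1 := h.hasSum_none hX hμ Subset.rfl (t := 0) self_mem_Ici
    rw [hμ.mulTransition_none_zero hX, sub_zero, mul_one] at h1
    have h2 := ((Option.some_injective (Alive D)).hasSum_iff (fun i hi => by
      cases i with
      | none => simp [hμ.cemetery]
      | some i => exact absurd ⟨i, rfl⟩ hi)).2 h1
    convert h2 using 2 with i
    have h3 : ∑' k, killedQ Q D (some i) k * killedTransition P X D k none 0
        = killingRate Q D i := by
      rw [tsum_eq_single none fun k hk => by simp [hX.killedTransition_zero, hk]]
      simp [killedQ, killedTransition]
    simp only [Function.comp, h3]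
    ring
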